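/- Let $A$ be the cyclic $5\times 5$ matrix with rows $(4,1,0,0,0),(0,4,1,0,0),(0,0,4,1,0),(0,0,0,4,1),(1,0,0,0,4)$. Let $d=1025$, which is the least positive integer with $dA^{-1}$ integral, and put $B=dA^{-1}$. For $t\in\mathbf C$ let $$X_{A,t}=Z\big(x_1^4x_2+x_2^4x_3+x_3^4x_4+x_4^4x_5+x_5^4x_1-5t\,x_1x_2x_3x_4x_5\big)\subset\mathbf P^4,$$ $$\overline M_t=Z\big(z_1+\dots+z_5-5tz_0,\;z_0^5-z_1z_2z_3z_4z_5\big)\subset\mathbf P^5 .$$ Let $\zeta$ be a primitive $d$-th root of unity and, for $a\in(\mathbf Z/d)^5$, let $g_a(x_1:\dots:x_5)=(\zeta^{a_1}x_1:\dots:\zeta^{a_5}x_5)$. Let $\Gamma_d$ be the group of all $g_a$ with $a_1+\dots+a_5\equiv0 \bmod 5$ (exponent vectors $a$ being taken modulo multiples of $(1,\dots,1)$). Then $g_a\mapsto g_{Ba}$ defines a homomorphism $\Gamma_d\to\mathrm{Aut}(X_{A,t})$; let $\Gamma_A$ be its kernel, $H_A$ its image, and $\hat g_0$ the image of $g_{(5,0,0,0,0)}$.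 For every primitive $d$-th root of unity $\zeta$ and every $t\in\mathbf C$: 1. $H_A=\langle\hat g_0\rangle$ is cyclic of order $41$. 2. $\Gamma_A\cong \mathbf Z/5\times(\mathbf Z/1025)^3$. 3. The automorphism $\hat g_0^{185}$ of $X_{A,t}$ has order $41$ and equals the automorphism of Doran–Greene–Judes $g_b$ with $b=25\cdot(1,37,16,18,10)$, that is, $(x_1:\dots:x_5)\mapsto(\eta x_1:\eta^{37}x_2:\eta^{16}x_3:\eta^{18}x_4:\eta^{10}x_5)$ with $\eta=\zeta^{25}$. 4. The quotient variety $X_{A,t}/H_A$ is birational to $\overline M_t$. -/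

import Mathlib

open scoped LinearAlgebra.Projectivization

namespace MirrorQuintic

/-! ### Complex varieties as spaces with functions -/

/-- A complex space with functions: a topological space with a sheaf of `ℂ`-algebras of
`ℂ`-valued functions. `RegularOn U f` says that `f` restricted to `U` is a section over `U`
(the values of `f` outside `U` are irrelevant); it is only used for open sets `U`. -/
structure FunctionSpace where
  Pt : Type
  top : TopologicalSpace Pt
  RegularOn : Set Pt → (Pt → ℂ) → Prop
  regularOn_congr : ∀ {U f g}, Set.EqOn f g U → RegularOn U f → RegularOn U g
  regularOn_mono : ∀ {U V f}, V ⊆ U → RegularOn U f → RegularOn V f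
  regularOn_glue : ∀ {U f},
    (∀ p ∈ U, ∃ V, IsOpen V ∧ p ∈ V ∧ RegularOn (U ∩ V) f) → RegularOn U f
  regularOn_const : ∀ U (c : ℂ), RegularOn U fun _ => c
  regularOn_add : ∀ {U f g}, RegularOn U f → RegularOn U g → RegularOn U (f + g)
  regularOn_mul : ∀ {U f g}, RegularOn U f → RegularOn U g → RegularOn U (f * g)

instance (X : FunctionSpace) : TopologicalSpace X.Pt := X.top

/-- The automorphism group of a space with functions: the self-homeomorphisms that identify the
regular functions on every open set with those on its preimage. -/
def Aut (X : FunctionSpace) : Subgroup (X.Pt ≃ₜ X.Pt) where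
  carrier := {e | ∀ (U : Set X.Pt) (f : X.Pt → ℂ), IsOpen U →
    (X.RegularOn U f ↔ X.RegularOn (e ⁻¹' U) (f ∘ e))}
  one_mem' := fun _ _ _ => Iff.rfl
  mul_mem' := by
    intro a b ha hb U f hU
    exact (ha U f hU).trans (hb _ _ (hU.preimage a.continuous))
  inv_mem' := by
    intro a ha U f hU
    have h := ha ((a⁻¹ : X.Pt ≃ₜ X.Pt) ⁻¹' U) (f ∘ (a⁻¹ : X.Pt ≃ₜ X.Pt))
      (hU.preimage (a⁻¹ : X.Pt ≃ₜ X.Pt).continuous)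
    have hc : ∀ x, (a⁻¹ : X.Pt ≃ₜ X.Pt) (a x) = x := fun x => a.symm_apply_apply x
    have h1 : a ⁻¹' ((a⁻¹ : X.Pt ≃ₜ X.Pt) ⁻¹' U) = U := by ext x; simp [hc]
    have h2 : (f ∘ (a⁻¹ : X.Pt ≃ₜ X.Pt)) ∘ a = f := by funext x; simp [hc]
    rw [h1, h2] at h
    exact h.symm

/-- Two points are equivalent when some element of `H` carries one to the other. -/
def orbitSetoid (X : FunctionSpace) (H : Subgroup (Aut X)) : Setoid X.Pt where
  r x y := ∃ h ∈ H, h.1 x = y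
  iseqv := by
    refine ⟨fun x => ⟨1, H.one_mem, rfl⟩, ?_, ?_⟩
    · rintro x _ ⟨h, hh, rfl⟩
      exact ⟨h⁻¹, H.inv_mem hh, h.1.symm_apply_apply x⟩
    · rintro x _ _ ⟨h, hh, rfl⟩ ⟨k, hk, rfl⟩
      exact ⟨k * h, H.mul_mem hk hh, rfl⟩

/-- The quotient `X / H`: the orbit space with the quotient topology, whose regular functions on
`U` are the functions whose pull-back to the preimage of `U` in `X` is regular, that is, the
`H`-invariant regular functions on that preimage. -/
def quotient (X : FunctionSpace) (H : Subgroup (Aut X)) : FunctionSpace where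
  Pt := Quotient (orbitSetoid X H)
  top := @instTopologicalSpaceQuotient _ (orbitSetoid X H) X.top
  RegularOn U f := X.RegularOn (Quotient.mk (orbitSetoid X H) ⁻¹' U)
    (f ∘ Quotient.mk (orbitSetoid X H))
  regularOn_congr h hf := X.regularOn_congr (fun x hx => h hx) hf
  regularOn_mono h hf := X.regularOn_mono (Set.preimage_mono h) hf
  regularOn_glue h := X.regularOn_glue fun p hp => by
    obtain ⟨V, hV, hpV, hf⟩ := h _ hp
    exact ⟨_, hV.preimage continuous_quotient_mk', hpV, hf⟩
  regularOn_const U c := X.regularOn_const _ c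
  regularOn_add hf hg := X.regularOn_add hf hg
  regularOn_mul hf hg := X.regularOn_mul hf hg

/-- `X` and `Y` are birational: a dense open subset of `X` is isomorphic, as a space with
functions, to a dense open subset of `Y`. -/
def Birational (X Y : FunctionSpace) : Prop :=
  ∃ e : OpenPartialHomeomorph X.Pt Y.Pt, Dense e.source ∧ Dense e.target ∧
    (∀ (V : Set Y.Pt) (f : Y.Pt → ℂ), IsOpen V → V ⊆ e.target → Y.RegularOn V f →
      X.RegularOn (e.source ∩ e ⁻¹' V) (f ∘ e)) ∧
    (∀ (U : Set X.Pt) (f : X.Pt → ℂ), IsOpen U → U ⊆ e.source → X.RegularOn U f →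
      Y.RegularOn (e.target ∩ e.symm ⁻¹' U) (f ∘ e.symm))

/-! ### Projective varieties over `ℂ` -/

/-- The Zariski topology on a complex projective space; it is generated by the complements of the
hypersurfaces. -/
instance zariski (ι : Type) : TopologicalSpace (ℙ ℂ (ι → ℂ)) :=
  .generateFrom {U | ∃ (k : ℕ) (P : MvPolynomial ι ℂ), P.IsHomogeneous k ∧
    U = {p | P.eval p.rep ≠ 0}}

/-- The common zero locus in projective space of a set of homogeneous polynomials. -/
def zeroLocus {ι : Type} (S : Set (MvPolynomial ι ℂ)) : Set (ℙ ℂ (ι → ℂ)) :=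
  {p | ∀ P ∈ S, P.eval p.rep = 0}

/-- `f` is, near every point of `U`, a quotient of two homogeneous polynomials of the same degree
with nowhere vanishing denominator. -/
def ProjRegularOn {ι : Type} {Z : Set (ℙ ℂ (ι → ℂ))} (U : Set Z) (f : Z → ℂ) : Prop :=
  ∀ p ∈ U, ∃ V : Set (ℙ ℂ (ι → ℂ)), IsOpen V ∧ p.1 ∈ V ∧
    ∃ (k : ℕ) (P Q : MvPolynomial ι ℂ), P.IsHomogeneous k ∧ Q.IsHomogeneous k ∧
      ∀ q ∈ U, q.1 ∈ V → Q.eval q.1.rep ≠ 0 ∧ f q = P.eval q.1.rep / Q.eval q.1.rep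

/-- A subset of projective space as a space with functions, with the induced Zariski topology and
the usual regular functions. -/
def projVariety {ι : Type} (Z : Set (ℙ ℂ (ι → ℂ))) : FunctionSpace where
  Pt := Z
  top := inferInstance
  RegularOn := ProjRegularOn
  regularOn_congr := by
    intro U f g h hf p hp
    obtain ⟨V, hV, hpV, k, P, Q, hP, hQ, H⟩ := hf p hp
    exact ⟨V, hV, hpV, k, P, Q, hP, hQ, fun q hq hqV => h hq ▸ H q hq hqV⟩
  regularOn_mono := by
    intro U W f h hf p hp
    obtain ⟨V, hV, hpV, k, P, Q, hP, hQ, H⟩ := hf p (h hp)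
    exact ⟨V, hV, hpV, k, P, Q, hP, hQ, fun q hq hqV => H q (h hq) hqV⟩
  regularOn_glue := by
    intro U f h p hp
    obtain ⟨W, ⟨W', hW', rfl⟩, hpW, hf⟩ := h p hp
    obtain ⟨V, hV, hpV, k, P, Q, hP, hQ, H⟩ := hf p ⟨hp, hpW⟩
    exact ⟨V ∩ W', hV.inter hW', ⟨hpV, hpW⟩, k, P, Q, hP, hQ,
      fun q hq hqV => H q ⟨hq, hqV.2⟩ hqV.1⟩
  regularOn_const := by
    intro U c p _
    exact ⟨Set.univ, isOpen_univ, trivial, 0, MvPolynomial.C c, 1,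
      MvPolynomial.isHomogeneous_C _ _, MvPolynomial.isHomogeneous_one _ _, by simp⟩
  regularOn_add := by
    intro U f g hf hg p hp
    obtain ⟨V, hV, hpV, k, P, Q, hP, hQ, H⟩ := hf p hp
    obtain ⟨V', hV', hpV', k', P', Q', hP', hQ', H'⟩ := hg p hp
    refine ⟨V ∩ V', hV.inter hV', ⟨hpV, hpV'⟩, k + k',
      P * Q' + Q * P', Q * Q', (hP.mul hQ').add (hQ.mul hP'), hQ.mul hQ', fun q hq hqV => ?_⟩
    obtain ⟨h1, h2⟩ := H q hq hqV.1
    obtain ⟨h1', h2'⟩ := H' q hq hqV.2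
    refine ⟨by simp [h1, h1'], ?_⟩
    simp only [Pi.add_apply, h2, h2', map_add, map_mul]
    field_simp
  regularOn_mul := by
    intro U f g hf hg p hp
    obtain ⟨V, hV, hpV, k, P, Q, hP, hQ, H⟩ := hf p hp
    obtain ⟨V', hV', hpV', k', P', Q', hP', hQ', H'⟩ := hg p hp
    refine ⟨V ∩ V', hV.inter hV', ⟨hpV, hpV'⟩, k + k',
      P * P', Q * Q', hP.mul hP', hQ.mul hQ', fun q hq hqV => ?_⟩
    obtain ⟨h1, h2⟩ := H q hq hqV.1
    obtain ⟨h1', h2'⟩ := H' q hq hqV.2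
    refine ⟨by simp [h1, h1'], ?_⟩
    simp only [Pi.mul_apply, h2, h2', map_mul]
    field_simp

/-! ### Diagonal automorphisms -/

/-- The linear map `(x_i) ↦ (c_i x_i)`. -/
noncomputable def diagLin {ι : Type} (c : ι → ℂˣ) : (ι → ℂ) →ₗ[ℂ] (ι → ℂ) where
  toFun x i := c i * x i
  map_add' x y := by funext i; simp [mul_add]
  map_smul' r x := by funext i; simp; ring

theorem diagLin_injective {ι : Type} (c : ι → ℂˣ) : Function.Injective (diagLin c) := by
  intro x y h
  funext i
  have := congrFun h i
  simpa [diagLin] using this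

/-- The automorphism `(x_i) ↦ (c_i x_i)` of projective space. -/
noncomputable def diagMap {ι : Type} (c : ι → ℂˣ) : ℙ ℂ (ι → ℂ) → ℙ ℂ (ι → ℂ) :=
  Projectivization.map (diagLin c) (diagLin_injective c)

theorem diagMap_mul {ι : Type} (c c' : ι → ℂˣ) (p : ℙ ℂ (ι → ℂ)) :
    diagMap (c * c') p = diagMap c (diagMap c' p) := by
  induction p using Projectivization.ind with
  | h v hv =>
    simp only [diagMap, Projectivization.map_mk]
    congr 1
    funext i
    simp [diagLin, mul_assoc]

theorem diagMap_const {ι : Type} (u : ℂˣ) (p : ℙ ℂ (ι → ℂ)) :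
    diagMap (fun _ => u) p = p := by
  induction p using Projectivization.ind with
  | h v hv =>
    simp only [diagMap, Projectivization.map_mk]
    rw [Projectivization.mk_eq_mk_iff]
    exact ⟨u, by funext i; simp [diagLin, Units.smul_def]⟩

theorem exists_rep_diagMap {ι : Type} (c : ι → ℂˣ) (p : ℙ ℂ (ι → ℂ)) :
    ∃ u : ℂˣ, (diagMap c p).rep = fun i => (u : ℂ) * (c i * p.rep i) := by
  have h : diagMap c p = Projectivization.mk ℂ (diagLin c p.rep)
      (by simpa using (diagLin_injective c).ne p.rep_nonzero) := by
    conv_lhs => rw [← p.mk_rep]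
    rfl
  obtain ⟨u, hu⟩ := Projectivization.exists_smul_eq_mk_rep ℂ (diagLin c p.rep)
      (by simpa using (diagLin_injective c).ne p.rep_nonzero)
  refine ⟨u, ?_⟩
  rw [h, ← hu]
  rfl

/-- The polynomial `P(c_i x_i)`. -/
noncomputable def rescale {ι : Type} (c : ι → ℂˣ) (P : MvPolynomial ι ℂ) : MvPolynomial ι ℂ :=
  MvPolynomial.aeval (fun i => MvPolynomial.C (c i : ℂ) * MvPolynomial.X i) P

theorem rescale_isHomogeneous {ι : Type} (c : ι → ℂˣ) {P : MvPolynomial ι ℂ} {k : ℕ}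
    (hP : P.IsHomogeneous k) : (rescale c P).IsHomogeneous k := by
  have := hP.aeval (fun i => MvPolynomial.C (c i : ℂ) * MvPolynomial.X i)
    (fun i => MvPolynomial.isHomogeneous_C_mul_X _ i)
  simpa [rescale] using this

theorem eval_rescale {ι : Type} (c : ι → ℂˣ) (P : MvPolynomial ι ℂ) (v : ι → ℂ) :
    (rescale c P).eval v = P.eval fun i => c i * v i := by
  induction P using MvPolynomial.induction_on with
  | C a => simp [rescale]
  | add p q hp hq =>
    simp only [rescale, map_add] at *
    rw [hp, hq]
  | mul_X p i hp =>
    simp only [rescale, map_mul] at *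
    rw [hp]
    simp

theorem eval_scale {ι : Type} {P : MvPolynomial ι ℂ} {k : ℕ} (hP : P.IsHomogeneous k)
    (u : ℂ) (v : ι → ℂ) : P.eval (fun i => u * v i) = u ^ k * P.eval v := by
  rw [MvPolynomial.eval_eq, MvPolynomial.eval_eq, Finset.mul_sum]
  refine Finset.sum_congr rfl fun m hm => ?_
  have hk : ∑ i ∈ m.support, m i = k := by
    have := hP (MvPolynomial.mem_support_iff.mp hm)
    simpa [Finsupp.weight_apply, Finsupp.sum] using this
  simp only [mul_pow, Finset.prod_mul_distrib, Finset.prod_pow_eq_pow_sum, hk]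
  ring

theorem exists_eval_diagMap {ι : Type} (c : ι → ℂˣ) (p : ℙ ℂ (ι → ℂ)) :
    ∃ u : ℂˣ, ∀ (k : ℕ) (P : MvPolynomial ι ℂ), P.IsHomogeneous k →
      P.eval (diagMap c p).rep = (u : ℂ) ^ k * (rescale c P).eval p.rep := by
  obtain ⟨u, hu⟩ := exists_rep_diagMap c p
  refine ⟨u, fun k P hP => ?_⟩
  rw [hu, eval_scale hP, eval_rescale]

theorem continuous_diagMap {ι : Type} (c : ι → ℂˣ) :
    Continuous (diagMap c) := by
  refine continuous_generateFrom_iff.mpr ?_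
  rintro _ ⟨k, P, hP, rfl⟩
  refine TopologicalSpace.isOpen_generateFrom_of_mem
    ⟨k, rescale c P, rescale_isHomogeneous c hP, ?_⟩
  ext p
  obtain ⟨u, hu⟩ := exists_eval_diagMap c p
  simp [hu k P hP]

theorem projRegularOn_diagMap {ι : Type} {Z : Set (ℙ ℂ (ι → ℂ))} (c : ι → ℂˣ)
    (h : ∀ p ∈ Z, diagMap c p ∈ Z) {U : Set Z} {f : Z → ℂ} (hf : ProjRegularOn U f) :
    ProjRegularOn ((fun p : Z => (⟨diagMap c p.1, h _ p.2⟩ : Z)) ⁻¹' U)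
      (fun p => f ⟨diagMap c p.1, h _ p.2⟩) := by
  intro p hp
  obtain ⟨V, hV, hpV, k, P, Q, hP, hQ, H⟩ := hf _ hp
  refine ⟨diagMap c ⁻¹' V, (continuous_diagMap c).isOpen_preimage V hV, hpV, k, rescale c P,
    rescale c Q, rescale_isHomogeneous c hP, rescale_isHomogeneous c hQ, fun q hq hqV => ?_⟩
  obtain ⟨h1, h2⟩ := H _ hq hqV
  obtain ⟨u, hu⟩ := exists_eval_diagMap c q.1
  have hu0 : (u : ℂ) ^ k ≠ 0 := pow_ne_zero _ u.ne_zero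
  rw [hu k Q hQ] at h1
  refine ⟨(mul_ne_zero_iff.mp h1).2, ?_⟩
  refine h2.trans ?_
  rw [hu k P hP, hu k Q hQ, mul_div_mul_left _ _ hu0]

/-- The diagonal matrices that preserve `Z`. -/
def diagStabilizer {ι : Type} (Z : Set (ℙ ℂ (ι → ℂ))) : Subgroup (ι → ℂˣ) where
  carrier := {c | ∀ p, diagMap c p ∈ Z ↔ p ∈ Z}
  one_mem' p := by
    have : diagMap (1 : ι → ℂˣ) p = p := diagMap_const 1 p
    rw [this]
  mul_mem' := by
    intro a b ha hb p
    rw [diagMap_mul, ha, hb]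
  inv_mem' := by
    intro a ha p
    rw [← ha, ← diagMap_mul, mul_inv_cancel]
    have : diagMap (1 : ι → ℂˣ) p = p := diagMap_const 1 p
    rw [this]

/-- A diagonal matrix that preserves `Z` acts on `Z` by an automorphism. -/
noncomputable def diagAut {ι : Type} (Z : Set (ℙ ℂ (ι → ℂ))) : diagStabilizer Z →* Aut (projVariety Z) where
  toFun c := ⟨{
      toFun := fun p => ⟨diagMap c.1 p.1, (c.2 _).mpr p.2⟩
      invFun := fun p => ⟨diagMap c.1⁻¹ p.1, ((diagStabilizer Z).inv_mem c.2 _).mpr p.2⟩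
      left_inv := fun p => Subtype.ext <| by
        change diagMap _ (diagMap _ _) = _
        rw [← diagMap_mul, inv_mul_cancel]
        exact diagMap_const 1 p.1
      right_inv := fun p => Subtype.ext <| by
        change diagMap _ (diagMap _ _) = _
        rw [← diagMap_mul, mul_inv_cancel]
        exact diagMap_const 1 p.1
      continuous_toFun := by
        exact ((continuous_diagMap c.1).comp continuous_subtype_val).subtype_mk _
      continuous_invFun := by
        exact ((continuous_diagMap c.1⁻¹).comp continuous_subtype_val).subtype_mk _ }, by
    intro U f _
    refine ⟨fun hf => projRegularOn_diagMap c.1 (fun p hp => (c.2 _).mpr hp) hf, fun hf => ?_⟩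
    have h := projRegularOn_diagMap c.1⁻¹
      (fun p hp => ((diagStabilizer Z).inv_mem c.2 _).mpr hp) hf
    have key : ∀ p : Z, (⟨diagMap c.1 (diagMap c.1⁻¹ p.1), (c.2 _).mpr
        (((diagStabilizer Z).inv_mem c.2 _).mpr p.2)⟩ : Z) = p := fun p => Subtype.ext <| by
      change diagMap _ (diagMap _ _) = _
      rw [← diagMap_mul, mul_inv_cancel]
      exact diagMap_const 1 p.1
    refine (projVariety Z).regularOn_congr ?_ ((projVariety Z).regularOn_mono ?_ h)
    · intro p _
      exact congrArg f (key p)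
    · intro p hp
      change (⟨diagMap c.1 (diagMap c.1⁻¹ p.1), _⟩ : Z) ∈ U
      rw [key p]
      exact hp⟩
  map_one' := Subtype.ext <| Homeomorph.ext fun p => Subtype.ext (diagMap_const 1 p.1)
  map_mul' a b := Subtype.ext <| Homeomorph.ext fun p => Subtype.ext (diagMap_mul a.1 b.1 p.1)

/-! ### The generalized Dwork pencils and the Shioda groups -/

/-- A square matrix `A` of non-negative integers, invertible over `ℚ`, whose row and column sums
are all equal to its size `n`, together with the least positive integer `d` for which `d A⁻¹` is
integral, and `B = d A⁻¹`. -/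
structure ShiodaMatrix (n : ℕ) where
  A : Matrix (Fin n) (Fin n) ℕ
  d : ℕ
  B : Matrix (Fin n) (Fin n) ℤ
  row_sum : ∀ i, ∑ j, A i j = n
  col_sum : ∀ j, ∑ i, A i j = n
  isLeast_d : IsLeast {d : ℕ | 0 < d ∧ ∃ B : Matrix (Fin n) (Fin n) ℤ,
    A.map (Nat.cast : ℕ → ℤ) * B = (d : ℤ) • (1 : Matrix (Fin n) (Fin n) ℤ)} d
  A_mul_B : A.map (Nat.cast : ℕ → ℤ) * B = (d : ℤ) • (1 : Matrix (Fin n) (Fin n) ℤ)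

/-- `F_{A,t} = ∑ i, ∏ j, x_j ^ a_{ij} - n t ∏ j, x_j`. -/
noncomputable def dworkPoly {n : ℕ} (A : Matrix (Fin n) (Fin n) ℕ) (t : ℂ) :
    MvPolynomial (Fin n) ℂ :=
  ∑ i, ∏ j, MvPolynomial.X j ^ A i j - MvPolynomial.C (n * t) * ∏ j, MvPolynomial.X j

/-- The set of points of `X_{A,t}`. -/
def dworkSet {n : ℕ} (A : Matrix (Fin n) (Fin n) ℕ) (t : ℂ) : Set (ℙ ℂ (Fin n → ℂ)) :=
  zeroLocus {dworkPoly A t}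

/-- The hypersurface `X_{A,t}` in `ℙ^{n-1}`. -/
def dworkVariety {n : ℕ} (A : Matrix (Fin n) (Fin n) ℕ) (t : ℂ) : FunctionSpace :=
  projVariety (dworkSet A t)

/-- The variety `z_1 + ... + z_n = n t z_0`, `z_0 ^ n = z_1 ⋯ z_n` in `ℙ^n`. -/
def mirrorVariety (n : ℕ) (t : ℂ) : FunctionSpace :=
  projVariety (zeroLocus
    {∑ i : Fin n, MvPolynomial.X i.succ - MvPolynomial.C (n * t) * MvPolynomial.X (0 : Fin (n + 1)),
      MvPolynomial.X (0 : Fin (n + 1)) ^ n - ∏ i : Fin n, MvPolynomial.X i.succ})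

/-- The exponent vectors `a ∈ (ℤ/d)^n` with `a_1 + ... + a_n ≡ 0 mod n`, for `n ∣ d`. -/
def exponents (n d : ℕ) : AddSubgroup (Fin n → ZMod d) where
  carrier := {a | ∃ k : ZMod d, ∑ i, a i = n * k}
  zero_mem' := ⟨0, by simp⟩
  add_mem' := by
    rintro a b ⟨k, hk⟩ ⟨l, hl⟩
    exact ⟨k + l, by simp [Finset.sum_add_distrib, hk, hl, mul_add]⟩
  neg_mem' := by
    rintro a ⟨k, hk⟩
    exact ⟨-k, by simp [hk]⟩

/-- The exponent vector `(1, ..., 1)`. -/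
def oneExp (n d : ℕ) : exponents n d := ⟨fun _ => 1, 1, by simp⟩

/-- The group `Γ_d`, written additively through exponent vectors. -/
abbrev Gam (n d : ℕ) : Type := exponents n d ⧸ AddSubgroup.zmultiples (oneExp n d)

/-- The diagonal matrix with entries `ζ ^ {a_i}`, for `ζ` with `ζ ^ d = 1`. -/
def zetaPow {n d : ℕ} (ζ : ℂˣ) (a : Fin n → ZMod d) : Fin n → ℂˣ := fun i => ζ ^ (a i).val

/-- The automorphism `g_a` of `ℙ^{n-1}`. -/
noncomputable def g {n d : ℕ} (ζ : ℂˣ) (a : Fin n → ZMod d) : ℙ ℂ (Fin n → ℂ) → ℙ ℂ (Fin n → ℂ) :=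
  diagMap (zetaPow ζ a)

/-- The additive character `a ↦ ζ ^ a` of `ℤ/d`. -/
def zetaChar {d : ℕ} [NeZero d] (ζ : ℂˣ) (hζ : ζ ^ d = 1) : Multiplicative (ZMod d) →* ℂˣ where
  toFun a := ζ ^ (Multiplicative.toAdd a).val
  map_one' := by simp
  map_mul' a b := by
    rw [toAdd_mul, ZMod.val_add, ← pow_add]
    exact (pow_eq_pow_mod _ hζ).symm

/-- The action of `B` on exponent vectors modulo `d`. -/
def mulB {n d : ℕ} (B : Matrix (Fin n) (Fin n) ℤ) (a : Fin n → ZMod d) : Fin n → ZMod d :=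
  (B.map (Int.cast : ℤ → ZMod d)).mulVec a

theorem dworkPoly_isHomogeneous {n : ℕ} {A : Matrix (Fin n) (Fin n) ℕ}
    (hA : ∀ i, ∑ j, A i j = n) (t : ℂ) : (dworkPoly A t).IsHomogeneous n := by
  refine MvPolynomial.IsHomogeneous.sub (MvPolynomial.IsHomogeneous.sum _ _ _ fun i _ => ?_)
    (MvPolynomial.IsHomogeneous.C_mul ?_ _)
  · have := MvPolynomial.IsHomogeneous.prod (R := ℂ) Finset.univ
      (fun j : Fin n => (MvPolynomial.X j : MvPolynomial (Fin n) ℂ) ^ A i j) (fun j => A i j)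
      fun j _ => MvPolynomial.isHomogeneous_X_pow j _
    rwa [hA i] at this
  · have := MvPolynomial.IsHomogeneous.prod (R := ℂ) Finset.univ
      (fun j : Fin n => (MvPolynomial.X j : MvPolynomial (Fin n) ℂ)) (fun _ => 1)
      fun j _ => MvPolynomial.isHomogeneous_X _ j
    simpa using this

namespace ShiodaMatrix

variable {n : ℕ} (D : ShiodaMatrix n)

instance : NeZero D.d := ⟨D.isLeast_d.1.1.ne'⟩

theorem B_col [NeZero n] : ∀ k, n * ∑ j, D.B j k = D.d := by
  intro k
  have h : ∀ i, ∑ j, (D.A i j : ℤ) * D.B j k = if i = k then (D.d : ℤ) else 0 := by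
    intro i
    have := congrFun (congrFun D.A_mul_B i) k
    simpa [Matrix.mul_apply, Matrix.one_apply] using this
  have h2 : ∑ i, ∑ j, (D.A i j : ℤ) * D.B j k = D.d := by simp [h]
  rw [Finset.sum_comm] at h2
  rw [← h2, Finset.mul_sum]
  refine Finset.sum_congr rfl fun j _ => ?_
  rw [← Finset.sum_mul]
  congr 1
  exact_mod_cast (D.col_sum j).symm

theorem B_mul_A : D.B * D.A.map (Nat.cast : ℕ → ℤ) =
    (D.d : ℤ) • (1 : Matrix (Fin n) (Fin n) ℤ) := by
  have hd : (D.d : ℤ) ≠ 0 := by exact_mod_cast D.isLeast_d.1.1.ne'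
  have h := D.A_mul_B
  set A' := D.A.map (Nat.cast : ℕ → ℤ)
  have hdet : A'.det ≠ 0 := by
    intro h0
    have := congrArg Matrix.det h
    rw [Matrix.det_mul, h0, zero_mul, Matrix.det_smul, Matrix.det_one, mul_one] at this
    exact pow_ne_zero _ hd this.symm
  have h2 : A' * (D.B * A') = A' * ((D.d : ℤ) • 1) := by
    rw [← Matrix.mul_assoc, h, Matrix.smul_mul, Matrix.mul_smul, Matrix.one_mul, Matrix.mul_one]
  have h3 := congrArg (fun M => A'.adjugate * M) h2
  simp only [← Matrix.mul_assoc, Matrix.adjugate_mul, Matrix.smul_mul, Matrix.one_mul] at h3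
  ext i j
  have := congrFun (congrFun h3 i) j
  simp only [Matrix.smul_apply, smul_eq_mul] at this
  simpa using mul_left_cancel₀ hdet this

theorem B_row [NeZero n] : ∀ j, n * ∑ k, D.B j k = D.d := by
  intro j
  have h : ∀ i, ∑ k, D.B j k * (D.A k i : ℤ) = if j = i then (D.d : ℤ) else 0 := by
    intro i
    have := congrFun (congrFun D.B_mul_A j) i
    simpa [Matrix.mul_apply, Matrix.one_apply] using this
  have h2 : ∑ i, ∑ k, D.B j k * (D.A k i : ℤ) = D.d := by simp [h]
  rw [Finset.sum_comm] at h2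
  rw [← h2, Finset.mul_sum]
  refine Finset.sum_congr rfl fun k _ => ?_
  rw [← Finset.mul_sum, mul_comm]
  congr 1
  exact_mod_cast (D.row_sum k).symm

theorem exists_m [NeZero n] : ∃ m : ℤ, n * m = D.d ∧ (∀ j, ∑ k, D.B j k = m) ∧
    ∀ k, ∑ j, D.B j k = m := by
  have hn : (n : ℤ) ≠ 0 := by exact_mod_cast NeZero.ne n
  refine ⟨∑ k, D.B 0 k, D.B_row 0, fun j => ?_, fun k => ?_⟩
  · exact mul_left_cancel₀ hn ((D.B_row j).trans (D.B_row 0).symm)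
  · exact mul_left_cancel₀ hn ((D.B_col k).trans (D.B_row 0).symm)

theorem sum_A_mulB (a : Fin n → ZMod D.d) (i : Fin n) :
    ∑ j, D.A i j • mulB D.B a j = 0 := by
  have h : ∀ k, ∑ j, (D.A i j : ℤ) * D.B j k = if i = k then (D.d : ℤ) else 0 := by
    intro k
    have := congrFun (congrFun D.A_mul_B i) k
    simpa [Matrix.mul_apply, Matrix.one_apply] using this
  have h' : ∀ k, ∑ j, (D.A i j : ZMod D.d) * (D.B j k : ZMod D.d) = 0 := by
    intro k
    have := congrArg (Int.cast : ℤ → ZMod D.d) (h k)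
    push_cast at this
    rw [this]
    split_ifs <;> simp
  simp only [mulB, Matrix.mulVec, dotProduct, Matrix.map_apply, nsmul_eq_mul, Finset.mul_sum]
  rw [Finset.sum_comm]
  simp only [← mul_assoc, ← Finset.sum_mul, h', zero_mul, Finset.sum_const_zero]

theorem sum_mulB [NeZero n] {a : Fin n → ZMod D.d} (ha : a ∈ exponents n D.d) :
    ∑ j, mulB D.B a j = 0 := by
  obtain ⟨m, hm, -, hc⟩ := D.exists_m
  obtain ⟨k, hk⟩ := ha
  simp only [mulB, Matrix.mulVec, dotProduct, Matrix.map_apply]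
  rw [Finset.sum_comm]
  have : ∀ k, ∑ j, (D.B j k : ZMod D.d) = m := fun k => by
    rw [← hc k]; push_cast; rfl
  simp only [← Finset.sum_mul, this, ← Finset.mul_sum, hk]
  have h2 : (n : ZMod D.d) * (m : ZMod D.d) = 0 := by
    have := congrArg (Int.cast : ℤ → ZMod D.d) hm
    push_cast at this
    rw [this]; simp
  rw [← mul_assoc, mul_comm (m : ZMod D.d), h2, zero_mul]

theorem zetaPow_mem [NeZero n] {ζ : ℂˣ} (hζ : ζ ^ D.d = 1) (t : ℂ) {a : Fin n → ZMod D.d}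
    (ha : a ∈ exponents n D.d) :
    zetaPow ζ (mulB D.B a) ∈ diagStabilizer (dworkSet D.A t) := by
  intro p
  set b := mulB D.B a with hb
  have hz : ∀ x : ZMod D.d, ζ ^ x.val = zetaChar ζ hζ (Multiplicative.ofAdd x) := fun _ => rfl
  have h1 : ∀ i, ∏ j, (zetaPow ζ b j) ^ D.A i j = 1 := by
    intro i
    simp only [zetaPow, hz, ← map_pow, ← map_prod, ← ofAdd_nsmul, ← ofAdd_sum]
    rw [hb, D.sum_A_mulB a i, ofAdd_zero, map_one]
  have h2 : ∏ j, zetaPow ζ b j = 1 := by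
    simp only [zetaPow, hz, ← map_prod, ← ofAdd_sum]
    rw [hb, D.sum_mulB ha, ofAdd_zero, map_one]
  have h1' : ∀ i, ∏ j, (zetaPow ζ b j : ℂ) ^ D.A i j = 1 := fun i => by
    have := congrArg (Units.val) (h1 i)
    simpa using this
  have h2' : ∏ j, (zetaPow ζ b j : ℂ) = 1 := by
    have := congrArg (Units.val) h2
    simpa using this
  obtain ⟨u, hu⟩ := exists_eval_diagMap (zetaPow ζ b) p
  have h3 := hu n _ (dworkPoly_isHomogeneous D.row_sum t)
  have h4 : (rescale (zetaPow ζ b) (dworkPoly D.A t)).eval p.rep =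
      (dworkPoly D.A t).eval p.rep := by
    rw [eval_rescale]
    simp [dworkPoly, mul_pow, Finset.prod_mul_distrib, h1', h2']
  simp [dworkSet, zeroLocus, h3, h4]

/-- The homomorphism `g_a ↦ g_{Ba}` on exponent vectors. -/
noncomputable def expHom [NeZero n] {ζ : ℂˣ} (hζ : ζ ^ D.d = 1) (t : ℂ) :
    Multiplicative (exponents n D.d) →* Aut (dworkVariety D.A t) :=
  (diagAut (dworkSet D.A t)).comp
    { toFun := fun a => ⟨zetaPow ζ (mulB D.B (Multiplicative.toAdd a).1),
        D.zetaPow_mem hζ t (Multiplicative.toAdd a).2⟩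
      map_one' := by
        refine Subtype.ext (funext fun i => ?_)
        simp [zetaPow, mulB]
      map_mul' := fun a b => by
        refine Subtype.ext (funext fun i => ?_)
        have := map_mul (zetaChar ζ hζ)
          (Multiplicative.ofAdd (mulB D.B (Multiplicative.toAdd a).1 i))
          (Multiplicative.ofAdd (mulB D.B (Multiplicative.toAdd b).1 i))
        rw [← ofAdd_add] at this
        simp only [mulB, toAdd_mul, AddSubgroup.coe_add, Matrix.mulVec_add] at *
        exact this }

theorem expHom_oneExp [NeZero n] {ζ : ℂˣ} (hζ : ζ ^ D.d = 1) (t : ℂ) :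
    D.expHom hζ t (Multiplicative.ofAdd (oneExp n D.d)) = 1 := by
  obtain ⟨m, -, hr, -⟩ := D.exists_m
  refine Subtype.ext (Homeomorph.ext fun p => Subtype.ext ?_)
  change diagMap (zetaPow ζ (mulB D.B fun _ => 1)) p.1 = p.1
  have : zetaPow ζ (mulB D.B fun _ => (1 : ZMod D.d)) = fun _ => ζ ^ (m : ZMod D.d).val := by
    funext i
    simp only [zetaPow, mulB, Matrix.mulVec, dotProduct, Matrix.map_apply, mul_one]
    rw [← hr i]
    push_cast
    rfl
  rw [this]
  exact diagMap_const _ _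

/-- The homomorphism `Γ_d → Aut(X_{A,t})`, `g_a ↦ g_{Ba}`. -/
noncomputable def shiodaHom [NeZero n] {ζ : ℂˣ} (hζ : ζ ^ D.d = 1) (t : ℂ) :
    Multiplicative (Gam n D.d) →* Aut (dworkVariety D.A t) :=
  AddMonoidHom.toMultiplicativeLeft <|
    QuotientAddGroup.lift (AddSubgroup.zmultiples (oneExp n D.d))
      (AddMonoidHom.toMultiplicativeLeft.symm (D.expHom hζ t)) <| by
        rw [AddSubgroup.zmultiples_le]
        exact D.expHom_oneExp hζ t

/-- `Γ_A`, the kernel of `Γ_d → Aut(X_{A,t})`. -/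
noncomputable def GamA [NeZero n] {ζ : ℂˣ} (hζ : ζ ^ D.d = 1) (t : ℂ) :
    Subgroup (Multiplicative (Gam n D.d)) := (D.shiodaHom hζ t).ker

/-- `H_A`, the image of `Γ_d → Aut(X_{A,t})`. -/
noncomputable def HA [NeZero n] {ζ : ℂˣ} (hζ : ζ ^ D.d = 1) (t : ℂ) :
    Subgroup (Aut (dworkVariety D.A t)) := (D.shiodaHom hζ t).range

/-- The element `g_0 = g_{(n, 0, ..., 0)}` of `Γ_d`. -/
def gen0 [NeZero n] : Multiplicative (Gam n D.d) :=
  Multiplicative.ofAdd (QuotientAddGroup.mk ⟨Pi.single 0 n, 1, by simp⟩)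

/-- The image of `g_0` in `Aut(X_{A,t})`. -/
noncomputable def gHat0 [NeZero n] {ζ : ℂˣ} (hζ : ζ ^ D.d = 1) (t : ℂ) :
    Aut (dworkVariety D.A t) := D.shiodaHom hζ t D.gen0

end ShiodaMatrix

/-- The matrix of the family `x_1^4 x_2 + x_2^4 x_3 + x_3^4 x_4 + x_4^4 x_5 + x_5^4 x_1`, for which
`d = 1025`. -/
def secondFamily : ShiodaMatrix 5 where
  A := !![4, 1, 0, 0, 0; 0, 4, 1, 0, 0; 0, 0, 4, 1, 0; 0, 0, 0, 4, 1; 1, 0, 0, 0, 4]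
  d := 1025
  B := !![256, -64, 16, -4, 1; 1, 256, -64, 16, -4; -4, 1, 256, -64, 16;
    16, -4, 1, 256, -64; -64, 16, -4, 1, 256]
  row_sum := by decide
  col_sum := by decide
  isLeast_d := by
    refine ⟨⟨by norm_num, !![256, -64, 16, -4, 1; 1, 256, -64, 16, -4; -4, 1, 256, -64, 16;
      16, -4, 1, 256, -64; -64, 16, -4, 1, 256], by decide⟩, ?_⟩
    rintro d ⟨hd, C, hC⟩
    have e : ∀ i, ∑ j, ((!![4, 1, 0, 0, 0; 0, 4, 1, 0, 0; 0, 0, 4, 1, 0; 0, 0, 0, 4, 1;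
        1, 0, 0, 0, 4] : Matrix (Fin 5) (Fin 5) ℕ) i j : ℤ) * C j 4 =
        if i = 4 then (d : ℤ) else 0 := by
      intro i
      have := congrFun (congrFun hC i) 4
      simpa [Matrix.mul_apply, Matrix.one_apply] using this
    have e0 := e 0
    have e1 := e 1
    have e2 := e 2
    have e3 := e 3
    have e4 := e 4
    simp [Fin.sum_univ_five] at e0 e1 e2 e3 e4
    omega
  A_mul_B := by decide

end MirrorQuintic

/-!
Modulo `1025` the matrix `B` has rank one: `B a = rowForm a • wt` with `wt = (1, -4, 16, -64, 256)`
and `rowForm a = (256, -64, 16, -4, 1) · a` (`mulB_secondFamily`). On exponent vectors of `Γ_d` the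
value `rowForm a` is divisible by `5`. Every member of the pencil has a point with nonzero
coordinates (`exists_torus_point`), so `g_{Ba}` is trivial on it exactly when `Ba` is constant, that
is, when `5 * rowForm a = 0` (`cyclicHom_eq_one_iff`). The claims on `H_A`, `Γ_A` and the
automorphism `ĝ₀^185` then become statements about `ℤ/1025`.

For the birational statement, the map
`x ↦ (x₁x₂x₃x₄x₅ : x₁⁴x₂ : x₂⁴x₃ : x₃⁴x₄ : x₄⁴x₅ : x₅⁴x₁)` is shown to be a geometric quotient by
`H_A` from the points of `X_{A,t}` with nonzero coordinates onto the points of the mirror variety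
with nonzero coordinates.

* It is surjective, and its fibres are the `H_A`-orbits, because the six monomials generate the
  lattice of all Laurent monomials whose `wt`-weight is divisible by `205` (`exists_monMap_eq`,
  `exists_twist_of_monMap_eq`, `monomial_identity`).
* A homogeneous polynomial `R` splits into its parts `R_c` of weight `c` modulo `205`. The parts
  vanish at `x` when `R` vanishes on the orbit of `x` (`eval_weightPart_eq_zero`), and on the torus
  each `R_c` is, up to a factor depending only on `c` and the degree, a homogeneous polynomial in the
  six monomials (`exists_descend_pair`). Hence images of open sets are open
  (`isOpen_image_quotMap`), and an invariant regular function `f = P / Q` equals `P_c / Q_c` for a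
  suitable `c` and descends (`projRegularOn_image_quotMap`).
* Both torus parts are dense, by the Nullstellensatz: a variable does not divide the equation of the
  hypersurface, hence is a nonzerodivisor modulo it (`eval_eq_zero_of_eval_eq_zero`). The mirror
  variety becomes a hypersurface in `ℙ⁴` after eliminating `z₅`.
-/

open scoped LinearAlgebra.Projectivization

namespace MirrorQuintic

/-! ### Homogeneous polynomials at representatives -/

theorem exists_eval_rep_mk {ι : Type} (v : ι → ℂ) (hv : v ≠ 0) :
    ∃ u : ℂˣ, ∀ (k : ℕ) (P : MvPolynomial ι ℂ), P.IsHomogeneous k →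
      P.eval (Projectivization.mk ℂ v hv).rep = (u : ℂ) ^ k * P.eval v := by
  obtain ⟨u, hu⟩ := Projectivization.exists_smul_eq_mk_rep ℂ v hv
  refine ⟨u, fun k P hP => ?_⟩
  rw [← hu, ← eval_scale hP]
  rfl

theorem eval_rep_mk_eq_zero {ι : Type} {v : ι → ℂ} (hv : v ≠ 0) {k : ℕ} {P : MvPolynomial ι ℂ}
    (hP : P.IsHomogeneous k) :
    P.eval (Projectivization.mk ℂ v hv).rep = 0 ↔ P.eval v = 0 := by
  obtain ⟨u, hu⟩ := exists_eval_rep_mk v hv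
  rw [hu k P hP, mul_eq_zero, or_iff_right (pow_ne_zero _ u.ne_zero)]

theorem eval_aeval {ι κ : Type} (σ : ι → MvPolynomial κ ℂ) (P : MvPolynomial ι ℂ) (v : κ → ℂ) :
    (MvPolynomial.aeval σ P).eval v = P.eval fun i => (σ i).eval v := by
  induction P using MvPolynomial.induction_on with
  | C a => simp
  | add p q hp hq => simp only [map_add, hp, hq]
  | mul_X p i hp => simp only [map_mul, hp, MvPolynomial.aeval_X, MvPolynomial.eval_X]

/-- A diagonal matrix fixing a point with nonzero coordinates is scalar. -/
theorem eq_of_diagMap_eq {ι : Type} {c : ι → ℂˣ} {p : ℙ ℂ (ι → ℂ)} (h : diagMap c p = p)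
    (hp : ∀ i, p.rep i ≠ 0) (i j : ι) : c i = c j := by
  obtain ⟨u, hu⟩ := exists_rep_diagMap c p
  rw [h] at hu
  have key : ∀ i, (u : ℂ) * c i = 1 := fun i => by
    have := congrFun hu i
    exact mul_right_cancel₀ (hp i) (by rw [one_mul, mul_assoc]; exact this.symm)
  exact Units.ext (mul_left_cancel₀ u.ne_zero ((key i).trans (key j).symm))

/-! ### The cyclic matrix -/

theorem eval_dworkPoly_secondFamily (t : ℂ) (v : Fin 5 → ℂ) :
    (dworkPoly secondFamily.A t).eval v =
      v 0 ^ 4 * v 1 + v 1 ^ 4 * v 2 + v 2 ^ 4 * v 3 + v 3 ^ 4 * v 4 + v 4 ^ 4 * v 0 -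
        5 * t * (v 0 * v 1 * v 2 * v 3 * v 4) := by
  simp [dworkPoly, secondFamily, Fin.sum_univ_five, Fin.prod_univ_five]
  ring

theorem dworkPoly_secondFamily_isHomogeneous (t : ℂ) :
    (dworkPoly secondFamily.A t).IsHomogeneous 5 :=
  dworkPoly_isHomogeneous secondFamily.row_sum t

/-- Every member of the pencil has a point with nonzero coordinates, namely `(r : 1 : 1 : 1 : 1)`
for a root `r` of `r ^ 4 + (1 - 5 t) r + 3`. -/
theorem exists_torus_point (t : ℂ) :
    ∃ p : dworkSet secondFamily.A t, ∀ i, p.1.rep i ≠ 0 := by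
  obtain ⟨r, hr⟩ := IsAlgClosed.exists_root
    (Polynomial.X ^ 4 + (Polynomial.C (1 - 5 * t) * Polynomial.X + Polynomial.C 3)) (by
      rw [Polynomial.degree_add_eq_left_of_degree_lt]
      · simp
      · rw [Polynomial.degree_X_pow]
        exact Polynomial.degree_linear_le.trans_lt (by norm_num))
  have hr' : r ^ 4 + ((1 - 5 * t) * r + 3) = 0 := by simpa [Polynomial.IsRoot] using hr
  have hr0 : r ≠ 0 := by
    rintro rfl
    norm_num at hr'
  have hv : (![r, 1, 1, 1, 1] : Fin 5 → ℂ) ≠ 0 := fun h => by simpa using congrFun h 1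
  refine ⟨⟨Projectivization.mk ℂ _ hv, ?_⟩, fun i => ?_⟩
  · rintro P rfl
    rw [eval_rep_mk_eq_zero hv (dworkPoly_secondFamily_isHomogeneous t),
      eval_dworkPoly_secondFamily]
    simp
    linear_combination hr'
  · have h := eval_rep_mk_eq_zero hv (MvPolynomial.isHomogeneous_X ℂ i)
    simp only [MvPolynomial.eval_X] at h
    rw [Ne, h]
    fin_cases i <;> simp [hr0]

/-- The last column of `B` modulo `1025`. All columns are multiples of it, as
`mulB_secondFamily` shows. -/
def wt : Fin 5 → ℤ := ![1, -4, 16, -64, 256]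

/-- The first row of `B` as a linear form modulo `1025`. -/
def rowForm (a : Fin 5 → ZMod 1025) : ZMod 1025 :=
  256 * a 0 - 64 * a 1 + 16 * a 2 - 4 * a 3 + a 4

theorem zmod_1025 : (1025 : ZMod 1025) = 0 := by
  exact_mod_cast ZMod.natCast_self 1025

theorem mulB_secondFamily (a : Fin 5 → ZMod 1025) (i : Fin 5) :
    mulB secondFamily.B a i = wt i * rowForm a := by
  have h := zmod_1025
  fin_cases i <;>
    simp [mulB, Matrix.mulVec, dotProduct, Fin.sum_univ_five, secondFamily, wt, rowForm]
  · ring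
  · linear_combination a 0 * h
  · linear_combination (-4 * a 0 + a 1) * h
  · linear_combination (16 * a 0 - 4 * a 1 + a 2) * h
  · linear_combination (-64 * a 0 + 16 * a 1 - 4 * a 2 + a 3) * h

/-! ### The groups -/

/-- The homomorphism `g_a ↦ g_{Ba}` of the cyclic family, with `d` unfolded to `1025`. -/
noncomputable def cyclicHom {ζ : ℂˣ} (hζ : ζ ^ 1025 = 1) (t : ℂ) :
    Multiplicative (Gam 5 1025) →* Aut (dworkVariety secondFamily.A t) :=
  secondFamily.shiodaHom hζ t

theorem cyclicHom_apply {ζ : ℂˣ} (hζ : ζ ^ 1025 = 1) (t : ℂ) (a : exponents 5 1025)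
    (p : dworkSet secondFamily.A t) :
    ((cyclicHom hζ t (Multiplicative.ofAdd (QuotientAddGroup.mk a))).1 p).1 =
      diagMap (zetaPow ζ (mulB secondFamily.B a.1)) p.1 := rfl

/-- `g_{Ba}` is trivial exactly when `Ba` is constant, that is, when `5 (256, -64, 16, -4, 1) · a`
vanishes. -/
theorem cyclicHom_eq_one_iff {ζ : ℂˣ} (hζ : IsPrimitiveRoot ζ 1025) (t : ℂ)
    (a : exponents 5 1025) :
    cyclicHom hζ.pow_eq_one t (Multiplicative.ofAdd (QuotientAddGroup.mk a)) = 1 ↔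
      5 * rowForm a.1 = 0 := by
  have hB : mulB secondFamily.B a.1 = fun i => (wt i : ZMod 1025) * rowForm a.1 :=
    funext (mulB_secondFamily a.1)
  constructor
  · intro h
    obtain ⟨p, hp⟩ := exists_torus_point t
    have h1 := cyclicHom_apply hζ.pow_eq_one t a p
    rw [h] at h1
    have h2 := eq_of_diagMap_eq h1.symm hp 0 1
    rw [hB] at h2
    have h3 := ZMod.val_injective 1025 (hζ.pow_inj (ZMod.val_lt _) (ZMod.val_lt _) h2)
    simp [wt] at h3
    linear_combination h3
  · intro h
    refine Subtype.ext (Homeomorph.ext fun (p : dworkSet secondFamily.A t) => Subtype.ext ?_)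
    rw [cyclicHom_apply, hB]
    have : zetaPow ζ (fun i => (wt i : ZMod 1025) * rowForm a.1) =
        fun _ => ζ ^ (rowForm a.1).val := by
      funext i
      have : (wt i : ZMod 1025) * rowForm a.1 = rowForm a.1 := by
        fin_cases i <;> simp [wt]
        · linear_combination -h
        · linear_combination 3 * h
        · linear_combination -13 * h
        · linear_combination 51 * h
      simp only [zetaPow, this]
    rw [this]
    exact diagMap_const _ _

theorem cyclicHom_eq_iff {ζ : ℂˣ} (hζ : IsPrimitiveRoot ζ 1025) (t : ℂ)
    (a b : exponents 5 1025) :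
    cyclicHom hζ.pow_eq_one t (Multiplicative.ofAdd (QuotientAddGroup.mk a)) =
      cyclicHom hζ.pow_eq_one t (Multiplicative.ofAdd (QuotientAddGroup.mk b)) ↔
      5 * rowForm a.1 = 5 * rowForm b.1 := by
  rw [← div_eq_one, ← map_div, ← ofAdd_sub]
  refine (cyclicHom_eq_one_iff hζ t (a - b)).trans ?_
  rw [← sub_eq_zero (a := 5 * rowForm a.1)]
  have : 5 * rowForm (a - b).1 = 5 * rowForm a.1 - 5 * rowForm b.1 := by
    simp [rowForm]
    ring
  rw [this]

/-- The exponent vector of `g_0`. -/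
def exp0 : exponents 5 1025 := ⟨Pi.single 0 5, 1, by simp⟩

/-- The element `ĝ₀`, the image of `g_0` under `cyclicHom`. -/
noncomputable def cyclicGen {ζ : ℂˣ} (hζ : ζ ^ 1025 = 1) (t : ℂ) :
    Aut (dworkVariety secondFamily.A t) :=
  cyclicHom hζ t (Multiplicative.ofAdd (QuotientAddGroup.mk exp0))

theorem cyclicGen_pow {ζ : ℂˣ} (hζ : ζ ^ 1025 = 1) (t : ℂ) (m : ℕ) :
    cyclicGen hζ t ^ m =
      cyclicHom hζ t (Multiplicative.ofAdd (QuotientAddGroup.mk (m • exp0))) := by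
  rw [cyclicGen, ← map_pow, ← ofAdd_nsmul]
  rfl

theorem rowForm_nsmul_exp0 (m : ℕ) : rowForm (m • exp0).1 = 255 * m := by
  have h := zmod_1025
  simp [rowForm, exp0]
  linear_combination (m : ZMod 1025) * h

/-- On exponent vectors in `Γ_d` the linear form `rowForm` takes values divisible by `5`. -/
theorem exists_rowForm_eq (a : exponents 5 1025) : ∃ j : ℕ, rowForm a.1 = 5 * j := by
  obtain ⟨a, k, hk⟩ := a
  refine ⟨(51 * a 0 - 13 * a 1 + 3 * a 2 - a 3 + k : ZMod 1025).val, ?_⟩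
  rw [ZMod.natCast_zmod_val]
  simp only [Fin.sum_univ_five] at hk
  push_cast at hk
  simp only [rowForm]
  linear_combination hk

theorem orderOf_cyclicGen {ζ : ℂˣ} (hζ : IsPrimitiveRoot ζ 1025) (t : ℂ) :
    orderOf (cyclicGen hζ.pow_eq_one t) = 41 := by
  have : Fact (Nat.Prime 41) := ⟨by norm_num⟩
  refine orderOf_eq_prime ?_ ?_
  · rw [cyclicGen_pow, cyclicHom_eq_one_iff hζ, rowForm_nsmul_exp0]
    decide
  · rw [← pow_one (cyclicGen hζ.pow_eq_one t), cyclicGen_pow, Ne, cyclicHom_eq_one_iff hζ,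
      rowForm_nsmul_exp0]
    decide

theorem range_cyclicHom {ζ : ℂˣ} (hζ : IsPrimitiveRoot ζ 1025) (t : ℂ) :
    (cyclicHom hζ.pow_eq_one t).range =
      Subgroup.zpowers (cyclicGen hζ.pow_eq_one t) := by
  refine le_antisymm ?_ ?_
  · rintro _ ⟨x, rfl⟩
    obtain ⟨a, rfl⟩ := QuotientAddGroup.mk_surjective (Multiplicative.toAdd x)
    obtain ⟨j, hj⟩ := exists_rowForm_eq a
    refine ⟨(37 * j : ℕ), ?_⟩
    simp only [zpow_natCast]
    rw [cyclicGen_pow]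
    -- `rowForm exp0 = 255 = 5 * 51`, and `37` inverts `51` modulo `41`: `51 * 37 = 1 + 46 * 41`
    refine (cyclicHom_eq_iff hζ t _ _).mpr ?_
    rw [hj, rowForm_nsmul_exp0]
    have h := zmod_1025
    push_cast
    linear_combination 46 * (j : ZMod 1025) * h
  · rw [Subgroup.zpowers_le]
    exact ⟨_, rfl⟩

theorem cyclicGen_pow_185_apply {ζ : ℂˣ} (hζ : ζ ^ 1025 = 1) (t : ℂ)
    (p : dworkSet secondFamily.A t) :
    ((cyclicGen hζ t ^ 185).1 p).1 =
      g ζ (25 • ![(1 : ZMod 1025), 37, 16, 18, 10]) p.1 := by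
  have key : mulB secondFamily.B (185 • exp0).1 = 25 • ![(1 : ZMod 1025), 37, 16, 18, 10] := by
    have h := zmod_1025
    funext i
    rw [mulB_secondFamily, rowForm_nsmul_exp0]
    fin_cases i <;> simp [wt]
    · linear_combination 46 * h
    · linear_combination -185 * h
    · linear_combination 736 * h
    · linear_combination -2946 * h
    · linear_combination 11782 * h
  rw [cyclicGen_pow, cyclicHom_apply, key, g]

/-! ### The structure of the kernel -/

/-- Multiplication by `205` as a homomorphism `ℤ/5 → ℤ/1025`. -/
def mul205 : ZMod 5 →+ ZMod 1025 :=
  ZMod.lift 5 ⟨(AddMonoidHom.mulLeft (205 : ZMod 1025)).comp (Int.castAddHom _), by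
    simp; decide⟩

theorem mul205_natCast (j : ℕ) : mul205 (j : ZMod 5) = 205 * j := by
  have := ZMod.lift_coe 5 (⟨(AddMonoidHom.mulLeft (205 : ZMod 1025)).comp (Int.castAddHom _), by
    simp; decide⟩ : {f : ℤ →+ ZMod 1025 // f (5 : ℕ) = 0}) j
  simpa [mul205] using this

theorem mul205_injective : Function.Injective mul205 := by
  rw [injective_iff_map_eq_zero]
  intro x hx
  rw [← ZMod.natCast_zmod_val x, mul205_natCast] at hx
  have h2 : ((205 * x.val : ℕ) : ZMod 1025) = 0 := by push_cast; exact hx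
  rw [ZMod.natCast_eq_zero_iff] at h2
  have := ZMod.val_lt x
  rw [← ZMod.val_eq_zero]
  omega

/-- An element of `ℤ/1025` killed by `5` is a multiple of `205`. -/
theorem exists_mul205_eq {x : ZMod 1025} (hx : 5 * x = 0) : ∃ σ, mul205 σ = x := by
  rw [← ZMod.natCast_zmod_val x] at hx ⊢
  have h2 : ((5 * x.val : ℕ) : ZMod 1025) = 0 := by push_cast; exact hx
  rw [ZMod.natCast_eq_zero_iff] at h2
  obtain ⟨k, hk⟩ := h2
  refine ⟨(k : ZMod 5), ?_⟩
  rw [mul205_natCast, show x.val = 205 * k by omega]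
  push_cast
  rfl

/-- The exponent vector with first coordinate `0`, middle coordinates `b` and with
`rowForm` equal to `205 σ`. -/
def kerVec (x : ZMod 5 × (Fin 3 → ZMod 1025)) : Fin 5 → ZMod 1025 :=
  ![0, x.2 0, x.2 1, x.2 2, mul205 x.1 + 64 * x.2 0 - 16 * x.2 1 + 4 * x.2 2]

theorem rowForm_kerVec (x : ZMod 5 × (Fin 3 → ZMod 1025)) :
    rowForm (kerVec x) = mul205 x.1 := by
  simp [rowForm, kerVec]

theorem kerVec_mem (x : ZMod 5 × (Fin 3 → ZMod 1025)) : kerVec x ∈ exponents 5 1025 := by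
  refine ⟨41 * x.1.val + 13 * x.2 0 - 3 * x.2 1 + x.2 2, ?_⟩
  have : mul205 x.1 = 205 * x.1.val := by
    rw [← mul205_natCast, ZMod.natCast_zmod_val]
  simp [Fin.sum_univ_five, kerVec, this]
  ring

/-- The parametrization of `Γ_A` by `ℤ/5 × (ℤ/1025)³`: every class in `Γ_A` has exactly one
representative of the form `kerVec x`. -/
def kerHom : ZMod 5 × (Fin 3 → ZMod 1025) →+ Gam 5 1025 :=
  (QuotientAddGroup.mk' _).comp
    { toFun := fun x => ⟨kerVec x, kerVec_mem x⟩
      map_zero' := Subtype.ext (by funext i; fin_cases i <;> simp [kerVec])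
      map_add' := fun x y => Subtype.ext (by
        funext i
        fin_cases i <;> simp [kerVec]
        ring) }

theorem kerHom_injective : Function.Injective kerHom := by
  rw [injective_iff_map_eq_zero]
  intro x hx
  obtain ⟨k, hk⟩ := (QuotientAddGroup.eq_zero_iff _).mp hx
  have hk' : ∀ i, (k : ZMod 1025) = kerVec x i := fun i => by
    have := congrFun (congrArg Subtype.val hk) i
    simpa [oneExp] using this
  have h0 : (k : ZMod 1025) = 0 := hk' 0
  have h1 := hk' 1
  have h2 := hk' 2
  have h3 := hk' 3
  have h4 := hk' 4
  simp only [h0] at h1 h2 h3 h4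
  simp [kerVec] at h1 h2 h3 h4
  have h5 : mul205 x.1 = 0 := by
    rw [← h1, ← h2, ← h3] at h4
    simpa using h4.symm
  refine Prod.ext ?_ (funext fun i => ?_)
  · exact (injective_iff_map_eq_zero _).mp mul205_injective _ h5
  · fin_cases i
    · exact h1.symm
    · exact h2.symm
    · exact h3.symm

theorem range_kerHom {ζ : ℂˣ} (hζ : IsPrimitiveRoot ζ 1025) (t : ℂ) :
    (AddMonoidHom.toMultiplicative kerHom).range = (cyclicHom hζ.pow_eq_one t).ker := by
  ext x
  constructor
  · rintro ⟨y, rfl⟩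
    refine (cyclicHom_eq_one_iff hζ t ⟨kerVec y.toAdd, kerVec_mem _⟩).mpr ?_
    have h := zmod_1025
    rw [rowForm_kerVec, ← ZMod.natCast_zmod_val (Multiplicative.toAdd y).1, mul205_natCast]
    linear_combination ((Multiplicative.toAdd y).1.val : ZMod 1025) * h
  · intro hx
    obtain ⟨a, ha⟩ := QuotientAddGroup.mk_surjective (Multiplicative.toAdd x)
    have hx' : 5 * rowForm a.1 = 0 := by
      refine (cyclicHom_eq_one_iff hζ t a).mp ?_
      rw [ha]
      exact hx
    have h := zmod_1025
    obtain ⟨σ, hσ⟩ := exists_mul205_eq (x := rowForm a.1 - 205 * a.1 0)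
      (by linear_combination hx' - a.1 0 * h)
    refine ⟨Multiplicative.ofAdd (σ, ![a.1 1 - a.1 0, a.1 2 - a.1 0, a.1 3 - a.1 0]), ?_⟩
    change kerHom _ = Multiplicative.toAdd x
    rw [← ha]
    refine QuotientAddGroup.eq.mpr ⟨(a.1 0).val, Subtype.ext (funext fun i => ?_)⟩
    simp [oneExp]
    fin_cases i <;> simp [kerVec]
    rw [hσ, rowForm]
    ring

theorem nonempty_ker_mulEquiv {ζ : ℂˣ} (hζ : IsPrimitiveRoot ζ 1025) (t : ℂ) :
    Nonempty ((cyclicHom hζ.pow_eq_one t).ker ≃*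
      Multiplicative (ZMod 5 × (Fin 3 → ZMod 1025))) :=
  ⟨((MonoidHom.ofInjective (f := AddMonoidHom.toMultiplicative kerHom)
    kerHom_injective).trans (MulEquiv.subgroupCongr (range_kerHom hζ t))).symm⟩

/-! ### Birational quotients -/

/-- A map `φ : X → Y` that restricts to a geometric quotient `S → T` of dense open sets for the
action of `H` induces a birational equivalence of `X / H` with `Y`. -/
theorem birational_quotient {X Y : FunctionSpace} [Nonempty X.Pt] {H : Subgroup (Aut X)}
    (φ : X.Pt → Y.Pt) {S : Set X.Pt} {T : Set Y.Pt}
    (hS : IsOpen S) (hSd : Dense S) (hTd : Dense T)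
    (hSH : ∀ h ∈ H, ∀ x ∈ S, h.1 x ∈ S)
    (hinv : ∀ h ∈ H, ∀ x ∈ S, φ (h.1 x) = φ x)
    (hmaps : Set.MapsTo φ S T) (hsurj : Set.SurjOn φ S T)
    (hfib : ∀ x ∈ S, ∀ y ∈ S, φ x = φ y → ∃ h ∈ H, h.1 x = y)
    (hcont : ContinuousOn φ S)
    (hopen : ∀ U ⊆ S, IsOpen U → IsOpen (φ '' U))
    (hpull : ∀ V f, IsOpen V → V ⊆ T → Y.RegularOn V f → X.RegularOn (S ∩ φ ⁻¹' V) (f ∘ φ))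
    (hdesc : ∀ U ⊆ S, IsOpen U → (∀ h ∈ H, ∀ x ∈ U, h.1 x ∈ U) → ∀ F : Y.Pt → ℂ,
      X.RegularOn U (F ∘ φ) → Y.RegularOn (φ '' U) F) :
    Birational (quotient X H) Y := by
  classical
  let s := orbitSetoid X H
  let π : X.Pt → (quotient X H).Pt := Quotient.mk s
  have hπ : Continuous π := continuous_quotient_mk'
  have hπsurj : Function.Surjective π := Quotient.mk_surjective
  have hπo : IsOpenQuotientMap π := by
    refine ⟨hπsurj, hπ, fun U hU => ?_⟩
    have : π ⁻¹' (π '' U) = ⋃ h : H, h.1.1 ⁻¹' U := by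
      ext x
      simp only [Set.mem_preimage, Set.mem_image, Set.mem_iUnion]
      constructor
      · rintro ⟨y, hy, hyx⟩
        obtain ⟨h, hh, hxy⟩ := Quotient.exact hyx.symm
        exact ⟨⟨h, hh⟩, by rw [hxy]; exact hy⟩
      · rintro ⟨h, hx⟩
        exact ⟨_, hx, (Quotient.sound ⟨h.1, h.2, rfl⟩ : π x = π (h.1.1 x)).symm⟩
    have hq : IsOpen (π ⁻¹' (π '' U)) := by
      rw [this]
      exact isOpen_iUnion fun h => hU.preimage h.1.1.continuous
    exact hq
  have hrel : ∀ {x y}, π x = π y → ∃ h ∈ H, h.1 x = y := fun hxy => Quotient.exact hxy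
  let ψ : (quotient X H).Pt → Y.Pt := fun q => φ (Quotient.out q)
  have hψ : ∀ x ∈ S, ψ (π x) = φ x := by
    intro x hx
    obtain ⟨h, hh, hxy⟩ := hrel (show π x = π (Quotient.out (π x)) from
      (Quotient.out_eq (π x)).symm)
    change φ (Quotient.out (π x)) = φ x
    rw [← hxy, hinv h hh x hx]
  have hS' : ∀ x, π x ∈ π '' S ↔ x ∈ S := by
    refine fun x => ⟨?_, fun hx => ⟨x, hx, rfl⟩⟩
    rintro ⟨y, hy, hyx⟩
    obtain ⟨h, hh, rfl⟩ := hrel hyx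
    exact hSH h hh y hy
  have hbij : Set.BijOn ψ (π '' S) T := by
    refine ⟨?_, ?_, ?_⟩
    · rintro _ ⟨x, hx, rfl⟩
      rw [hψ x hx]
      exact hmaps hx
    · rintro _ ⟨x, hx, rfl⟩ _ ⟨y, hy, rfl⟩ hxy
      rw [hψ x hx, hψ y hy] at hxy
      obtain ⟨h, hh, h'⟩ := hfib x hx y hy hxy
      exact Quotient.sound ⟨h, hh, h'⟩
    · intro z hz
      obtain ⟨x, hx, rfl⟩ := hsurj hz
      exact ⟨π x, ⟨x, hx, rfl⟩, hψ x hx⟩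
  have hne : Nonempty (quotient X H).Pt := ‹Nonempty X.Pt›.map π
  have himg : ∀ W : Set (quotient X H).Pt, ψ '' (π '' S ∩ W) = φ '' (S ∩ π ⁻¹' W) := by
    intro W
    ext z
    constructor
    · rintro ⟨_, ⟨⟨x, hx, rfl⟩, hW⟩, rfl⟩
      exact ⟨x, ⟨hx, hW⟩, (hψ x hx).symm⟩
    · rintro ⟨x, ⟨hx, hW⟩, rfl⟩
      exact ⟨π x, ⟨⟨x, hx, rfl⟩, hW⟩, hψ x hx⟩
  let E := Set.BijOn.toPartialEquiv ψ (π '' S) T hbij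
  have hpre : ∀ V : Set Y.Pt, π ⁻¹' (π '' S ∩ ψ ⁻¹' V) = S ∩ φ ⁻¹' V := by
    intro V
    ext x
    simp only [Set.mem_preimage, Set.mem_inter_iff, hS']
    exact and_congr_right fun hx => by rw [hψ x hx]
  let e : OpenPartialHomeomorph (quotient X H).Pt Y.Pt :=
    OpenPartialHomeomorph.ofContinuousOpenRestrict E
      (by
        refine (continuousOn_open_iff (hπo.isOpenMap _ hS)).mpr fun V hV => ?_
        rw [← hπo.isQuotientMap.isOpen_preimage]
        have := hcont.isOpen_inter_preimage hS hV
        rw [← hpre] at this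
        exact this)
      (by
        rintro _ ⟨W, hW, rfl⟩
        have h1 : E.source.domRestrict E '' (Subtype.val ⁻¹' W) = ψ '' (π '' S ∩ W) := by
          ext z
          constructor
          · rintro ⟨⟨q, hq⟩, hqW, rfl⟩
            exact ⟨q, ⟨hq, hqW⟩, rfl⟩
          · rintro ⟨q, ⟨hq, hqW⟩, rfl⟩
            exact ⟨⟨q, hq⟩, hqW, rfl⟩
        rw [h1, himg]
        exact hopen _ Set.inter_subset_left (hS.inter (hW.preimage hπ)))
      (hπo.isOpenMap _ hS)
  refine ⟨e, ?_, hTd, ?_, ?_⟩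
  · exact hπsurj.denseRange.dense_image hπ hSd
  · intro V f hV hVT hf
    change X.RegularOn (π ⁻¹' (π '' S ∩ ψ ⁻¹' V)) (f ∘ ψ ∘ π)
    rw [hpre]
    refine X.regularOn_congr ?_ (hpull V f hV hVT hf)
    intro x hx
    exact congrArg f (hψ x hx.1).symm
  · intro U f hU hUS hf
    have hUS' : ∀ x, π x ∈ U → x ∈ S := fun x hx => (hS' x).mp (hUS hx)
    have h1 : e.target ∩ e.symm ⁻¹' U = φ '' (π ⁻¹' U) := by
      have h3 : e.target ∩ e.symm ⁻¹' U = e '' U := by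
        rw [e.image_eq_target_inter_inv_preimage hUS]
      have h4 := himg U
      have h5 : π '' S ∩ U = U := Set.inter_eq_right.mpr hUS
      have h6 : S ∩ π ⁻¹' U = π ⁻¹' U := Set.inter_eq_right.mpr hUS'
      rw [h5, h6] at h4
      exact h3.trans h4
    rw [h1]
    refine hdesc _ hUS' (hU.preimage hπ) ?_ _ ?_
    · intro h hh x hx
      have : π (h.1 x) = π x := (Quotient.sound ⟨h, hh, rfl⟩ : π x = π (h.1 x)).symm
      exact (congrArg (· ∈ U) this).mpr hx
    · refine X.regularOn_congr ?_ hf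
      intro x hx
      change f (π x) = f (e.symm (φ x))
      rw [← hψ x (hUS' x hx)]
      exact (congrArg f (e.left_inv (hUS hx))).symm

/-! ### Zariski open sets and density -/

/-- The principal open sets form a basis of the Zariski topology. -/
theorem exists_principal_subset {ι : Type} {U : Set (ℙ ℂ (ι → ℂ))} (hU : IsOpen U)
    {p : ℙ ℂ (ι → ℂ)} (hp : p ∈ U) :
    ∃ (k : ℕ) (R : MvPolynomial ι ℂ), R.IsHomogeneous k ∧ R.eval p.rep ≠ 0 ∧
      ∀ q : ℙ ℂ (ι → ℂ), R.eval q.rep ≠ 0 → q ∈ U := by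
  induction hU with
  | basic V hV =>
    obtain ⟨k, R, hR, rfl⟩ := hV
    exact ⟨k, R, hR, hp, fun q hq => hq⟩
  | univ => exact ⟨0, 1, MvPolynomial.isHomogeneous_one _ _, by simp, fun _ _ => trivial⟩
  | inter V W _ _ hV hW =>
    obtain ⟨k, R, hR, hRp, hRV⟩ := hV hp.1
    obtain ⟨l, Q, hQ, hQp, hQW⟩ := hW hp.2
    refine ⟨k + l, R * Q, hR.mul hQ, by simp [hRp, hQp], fun q hq => ?_⟩
    rw [map_mul] at hq
    exact ⟨hRV q (left_ne_zero_of_mul hq), hQW q (right_ne_zero_of_mul hq)⟩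
  | sUnion C _ ih =>
    obtain ⟨V, hV, hpV⟩ := hp
    obtain ⟨k, R, hR, hRp, hRV⟩ := ih V hV hpV
    exact ⟨k, R, hR, hRp, fun q hq => ⟨V, hV, hRV q hq⟩⟩

theorem isOpen_principal {ι : Type} {k : ℕ} {R : MvPolynomial ι ℂ} (hR : R.IsHomogeneous k) :
    IsOpen {p : ℙ ℂ (ι → ℂ) | R.eval p.rep ≠ 0} :=
  TopologicalSpace.isOpen_generateFrom_of_mem ⟨k, R, hR, rfl⟩

theorem dense_principal {ι : Type} (Z : Set (ℙ ℂ (ι → ℂ))) {M : MvPolynomial ι ℂ}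
    (h : ∀ (k : ℕ) (P : MvPolynomial ι ℂ), P.IsHomogeneous k →
      (∀ p ∈ Z, M.eval p.rep ≠ 0 → P.eval p.rep = 0) → ∀ p ∈ Z, P.eval p.rep = 0) :
    Dense {p : Z | M.eval p.1.rep ≠ 0} := by
  rw [dense_iff_inter_open]
  rintro _ ⟨U, hU, rfl⟩ ⟨p, hp⟩
  obtain ⟨k, R, hR, hRp, hRU⟩ := exists_principal_subset hU hp
  by_contra hne
  refine hRp (h k R hR (fun q hq hMq => ?_) p.1 p.2)
  by_contra hRq
  exact hne ⟨⟨q, hq⟩, hRU q hRq, hMq⟩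

/-- If `M` is a nonzerodivisor modulo `F`, a polynomial vanishing on the part of the hypersurface
`F = 0` where `M ≠ 0` vanishes on the whole hypersurface, by the Nullstellensatz. -/
theorem eval_eq_zero_of_eval_eq_zero {ι : Type} [Finite ι] {F M P : MvPolynomial ι ℂ}
    (hFM : ∀ Q, F ∣ M * Q → F ∣ Q)
    (hP : ∀ v, F.eval v = 0 → M.eval v ≠ 0 → P.eval v = 0) {v : ι → ℂ} (hv : F.eval v = 0) :
    P.eval v = 0 := by
  have hmem : M * P ∈ (Ideal.span {F}).radical := by
    rw [← MvPolynomial.vanishingIdeal_zeroLocus_eq_radical (K := ℂ),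
      MvPolynomial.mem_vanishingIdeal_iff]
    intro x hx
    have hx' : F.eval x = 0 := by
      have := hx F (Ideal.subset_span rfl)
      simpa [MvPolynomial.aeval_eq_eval] using this
    have : (M * P).eval x = 0 := by
      by_cases hM : M.eval x = 0
      · simp [hM]
      · simp [hP x hx' hM]
    simpa [MvPolynomial.aeval_eq_eval] using this
  obtain ⟨N, hN⟩ := hmem
  rw [Ideal.mem_span_singleton, mul_pow] at hN
  have hcancel : ∀ n Q, F ∣ M ^ n * Q → F ∣ Q := by
    intro n
    induction n with
    | zero => simp
    | succ n ih =>
      intro Q hQ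
      refine ih Q (hFM _ ?_)
      rwa [← mul_assoc, ← pow_succ']
  obtain ⟨G, hG⟩ := hcancel N _ hN
  have := congrArg (MvPolynomial.eval v) hG
  rw [map_pow, map_mul, hv, zero_mul] at this
  by_contra hne
  exact pow_ne_zero N hne this

/-- A variable not dividing `F` is a nonzerodivisor modulo `F`. -/
theorem dvd_of_dvd_X_mul {ι : Type} {F : MvPolynomial ι ℂ} {i : ι}
    {v : ι → ℂ} (hvi : v i = 0) (hv : F.eval v ≠ 0) (Q : MvPolynomial ι ℂ)
    (h : F ∣ MvPolynomial.X i * Q) : F ∣ Q := by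
  obtain ⟨G, hG⟩ := h
  have hX : Prime (MvPolynomial.X i : MvPolynomial ι ℂ) := MvPolynomial.X_prime
  obtain h1 | ⟨G', rfl⟩ := hX.dvd_or_dvd ⟨Q, hG.symm⟩
  · obtain ⟨F', rfl⟩ := h1
    simp [hvi] at hv
  · refine ⟨G', mul_left_cancel₀ hX.ne_zero ?_⟩
    rw [hG]
    ring

/-! ### Weight components and the monomial map -/

theorem sum_zpow_rootOfUnity {n : ℕ} {θ : ℂˣ} (hθ : IsPrimitiveRoot θ n) (e : ℤ) :
    ∑ j ∈ Finset.range n, (((θ ^ j) ^ e : ℂˣ) : ℂ) = if (e : ZMod n) = 0 then (n : ℂ) else 0 := by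
  have h : ∀ j : ℕ, (((θ ^ j) ^ e : ℂˣ) : ℂ) = ((θ ^ e : ℂˣ) : ℂ) ^ j := fun j => by
    rw [← Units.val_pow_eq_pow_val, ← zpow_natCast, ← zpow_natCast, ← zpow_mul, ← zpow_mul,
      mul_comm]
  simp only [h]
  have hdvd : (e : ZMod n) = 0 ↔ θ ^ e = 1 := by
    rw [hθ.zpow_eq_one_iff_dvd, ZMod.intCast_zmod_eq_zero_iff_dvd]
  split_ifs with h1
  · simp [hdvd.mp h1]
  · have h2 : ((θ ^ e : ℂˣ) : ℂ) - 1 ≠ 0 := by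
      rw [sub_ne_zero]
      exact fun h3 => h1 (hdvd.mpr (Units.ext h3))
    refine (mul_eq_zero.mp ?_).resolve_right h2
    rw [geom_sum_mul, ← Units.val_pow_eq_pow_val, ← zpow_natCast, ← zpow_mul, mul_comm e, zpow_mul,
      zpow_natCast, hθ.pow_eq_one]
    simp

/-- The diagonal matrix `(ε ^ {w_i})`. -/
def twist {ι : Type} (w : ι → ℤ) (ε : ℂˣ) : ι → ℂˣ := fun i => ε ^ w i

/-- The part of `R` spanned by the monomials of weight `c` modulo `n`. -/
noncomputable abbrev weightPart {ι : Type} (n : ℕ) (w : ι → ℤ) (c : ZMod n) :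
    MvPolynomial ι ℂ →ₗ[ℂ] MvPolynomial ι ℂ :=
  MvPolynomial.weightedHomogeneousComponent (fun i => (w i : ZMod n)) c

theorem weight_cast {ι : Type} [Fintype ι] (n : ℕ) (w : ι → ℤ) (m : ι →₀ ℕ) :
    Finsupp.weight (fun i => (w i : ZMod n)) m = ((∑ i, w i * m i : ℤ) : ZMod n) := by
  rw [Finsupp.weight_apply, Finsupp.sum_fintype _ _ (by simp)]
  push_cast
  exact Finset.sum_congr rfl fun i _ => by rw [nsmul_eq_mul, mul_comm]

theorem eval_twist_monomial {ι : Type} [Fintype ι] (w : ι → ℤ) (ε : ℂˣ) (v : ι → ℂ) (m : ι →₀ ℕ)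
    (a : ℂ) :
    (MvPolynomial.monomial m a).eval (fun i => (twist w ε i : ℂ) * v i) =
      ((ε ^ (∑ i, w i * m i : ℤ) : ℂˣ) : ℂ) * (MvPolynomial.monomial m a).eval v := by
  rw [MvPolynomial.eval_monomial, MvPolynomial.eval_monomial, Finsupp.prod_fintype _ _ (by simp),
    Finsupp.prod_fintype _ _ (by simp)]
  simp only [mul_pow, Finset.prod_mul_distrib]
  have : ∏ i, (twist w ε i : ℂ) ^ m i = ((ε ^ (∑ i, w i * m i : ℤ) : ℂˣ) : ℂ) := by
    have h : ∀ s : Finset ι, ∏ i ∈ s, twist w ε i ^ m i = ε ^ (∑ i ∈ s, w i * m i : ℤ) := by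
      classical
      intro s
      induction s using Finset.induction_on with
      | empty => simp
      | insert i s hi ih =>
        rw [Finset.prod_insert hi, Finset.sum_insert hi, ih, zpow_add, zpow_mul, zpow_natCast]
        rfl
    rw [← h]
    simp
  rw [this]
  ring

theorem weightPart_monomial {ι : Type} [Fintype ι] (n : ℕ) (w : ι → ℤ) (c : ZMod n) (m : ι →₀ ℕ)
    (a : ℂ) : weightPart n w c (MvPolynomial.monomial m a) =
      if ((∑ i, w i * m i : ℤ) : ZMod n) = c then MvPolynomial.monomial m a else 0 := by
  classical
  ext d
  rw [MvPolynomial.coeff_weightedHomogeneousComponent]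
  by_cases hd : m = d
  · subst hd
    rw [weight_cast]
    split_ifs <;> simp
  · split_ifs <;> simp [hd]

/-- The discrete Fourier transform over the group of the matrices `(θ^{j w_i})` extracts the
weight parts. -/
theorem sum_twist_eq_weightPart {ι : Type} [Fintype ι] {n : ℕ} [NeZero n] {θ : ℂˣ}
    (hθ : IsPrimitiveRoot θ n) (w : ι → ℤ) (R : MvPolynomial ι ℂ) (v : ι → ℂ) (c : ZMod n) :
    ∑ j ∈ Finset.range n, (((θ ^ j) ^ (-(c.val : ℤ)) : ℂˣ) : ℂ) *
      R.eval (fun i => (twist w (θ ^ j) i : ℂ) * v i) = n * (weightPart n w c R).eval v := by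
  induction R using MvPolynomial.induction_on' with
  | monomial m a =>
    simp only [eval_twist_monomial, ← mul_assoc, ← Units.val_mul, ← zpow_add]
    rw [← Finset.sum_mul, sum_zpow_rootOfUnity hθ, weightPart_monomial]
    have : (((-(c.val : ℤ) + ∑ i, w i * m i : ℤ)) : ZMod n) = 0 ↔
        ((∑ i, w i * m i : ℤ) : ZMod n) = c := by
      rw [Int.cast_add, Int.cast_neg, Int.cast_natCast, ZMod.natCast_zmod_val, neg_add_eq_zero,
        eq_comm]
    simp only [this]
    split_ifs <;> simp
  | add p q hp hq => simp only [map_add, mul_add, Finset.sum_add_distrib, hp, hq]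

/-- If `R` vanishes on the orbit of `v`, so do its weight parts. -/
theorem eval_weightPart_eq_zero {ι : Type} [Fintype ι] {n : ℕ} [NeZero n] {θ : ℂˣ}
    (hθ : IsPrimitiveRoot θ n) (w : ι → ℤ) {R : MvPolynomial ι ℂ} {v : ι → ℂ}
    (h : ∀ j : ℕ, R.eval (fun i => (twist w (θ ^ j) i : ℂ) * v i) = 0) (c : ZMod n) :
    (weightPart n w c R).eval v = 0 := by
  have h1 := sum_twist_eq_weightPart hθ w R v c
  simp only [h, mul_zero, Finset.sum_const_zero] at h1
  exact (mul_eq_zero.mp h1.symm).resolve_left (by exact_mod_cast NeZero.ne n)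

theorem exists_eval_weightPart_ne_zero {ι : Type} {n : ℕ} [NeZero n] (w : ι → ℤ)
    {R : MvPolynomial ι ℂ} {v : ι → ℂ} (h : R.eval v ≠ 0) :
    ∃ c : ZMod n, (weightPart n w c R).eval v ≠ 0 := by
  by_contra! h0
  apply h
  rw [← MvPolynomial.sum_weightedHomogeneousComponent (fun i => (w i : ZMod n)) R,
    finsum_eq_sum_of_fintype, map_sum]
  exact Finset.sum_eq_zero fun c _ => h0 c

/-- The monomials `x₁x₂x₃x₄x₅, x₁⁴x₂, …, x₅⁴x₁`. -/
noncomputable def monPoly : Fin 6 → MvPolynomial (Fin 5) ℂ :=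
  ![.X 0 * .X 1 * .X 2 * .X 3 * .X 4, .X 0 ^ 4 * .X 1, .X 1 ^ 4 * .X 2, .X 2 ^ 4 * .X 3,
    .X 3 ^ 4 * .X 4, .X 4 ^ 4 * .X 0]

/-- The map of affine spaces given by the monomials `monPoly`. -/
def monMap (v : Fin 5 → ℂ) : Fin 6 → ℂ :=
  ![v 0 * v 1 * v 2 * v 3 * v 4, v 0 ^ 4 * v 1, v 1 ^ 4 * v 2, v 2 ^ 4 * v 3, v 3 ^ 4 * v 4,
    v 4 ^ 4 * v 0]

theorem eval_monPoly (v : Fin 5 → ℂ) (i : Fin 6) : (monPoly i).eval v = monMap v i := by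
  fin_cases i <;> simp [monPoly, monMap]

theorem monPoly_isHomogeneous (i : Fin 6) : (monPoly i).IsHomogeneous 5 := by
  have h := fun j : Fin 5 => MvPolynomial.isHomogeneous_X ℂ j
  have h4 : ∀ j l : Fin 5, (MvPolynomial.X j ^ 4 * MvPolynomial.X l :
      MvPolynomial (Fin 5) ℂ).IsHomogeneous 5 := fun j l => ((h j).pow 4).mul (h l)
  fin_cases i
  · exact ((((h 0).mul (h 1)).mul (h 2)).mul (h 3)).mul (h 4)
  · exact h4 0 1
  · exact h4 1 2
  · exact h4 2 3
  · exact h4 3 4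
  · exact h4 4 0

theorem eval_aeval_monPoly (P : MvPolynomial (Fin 6) ℂ) (v : Fin 5 → ℂ) :
    (MvPolynomial.aeval monPoly P).eval v = P.eval (monMap v) := by
  rw [eval_aeval, funext (eval_monPoly v)]

theorem monMap_ne_zero {v : Fin 5 → ℂ} (hv : ∀ i, v i ≠ 0) (i : Fin 6) : monMap v i ≠ 0 := by
  fin_cases i <;> simp [monMap, hv]

theorem monMap_zero_ne_zero_iff {v : Fin 5 → ℂ} : monMap v 0 ≠ 0 ↔ ∀ i, v i ≠ 0 := by
  simp [monMap, Fin.forall_fin_succ]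
  tauto

theorem monMap_smul (u : ℂ) (v : Fin 5 → ℂ) : monMap (fun i => u * v i) = u ^ 5 • monMap v := by
  funext i
  fin_cases i <;> simp [monMap] <;> ring

theorem monMap_twist {ε : ℂˣ} (hε : ε ^ 205 = 1) (v : Fin 5 → ℂ) :
    monMap (fun i => (twist wt ε i : ℂ) * v i) = monMap v := by
  have h : (ε : ℂ) ^ 205 = 1 := by
    rw [← Units.val_pow_eq_pow_val, hε, Units.val_one]
  have h' : (ε : ℂ) ^ 1025 = 1 := by
    rw [show 1025 = 205 * 5 by norm_num, pow_mul, h, one_pow]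
  have h0 := ε.ne_zero
  funext i
  fin_cases i <;> simp [monMap, twist, wt] <;> field_simp
  · rw [h, one_mul]
  · rw [h', one_mul]

/-- Every `z` in the torus with `z₀⁵ = z₁z₂z₃z₄z₅` is in the image of `monMap`: the monomials
`x₁^205` and `x_{i+1} x₁^{-wt i}` are Laurent monomials in `z`. -/
theorem exists_monMap_eq {z : Fin 6 → ℂ} (hz : ∀ i, z i ≠ 0)
    (h : z 0 ^ 5 = z 1 * z 2 * z 3 * z 4 * z 5) : ∃ v, (∀ i, v i ≠ 0) ∧ monMap v = z := by
  obtain ⟨y, hy⟩ := IsAlgClosed.exists_pow_nat_eq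
    (z 0 * z 1 ^ 51 * z 3 ^ 3 / (z 2 ^ 13 * z 4)) (n := 205) (by norm_num)
  have h0 := hz 0
  have h1 := hz 1
  have h2 := hz 2
  have h3 := hz 3
  have h4 := hz 4
  have hy0 : y ≠ 0 := by
    rintro rfl
    rw [zero_pow (by norm_num), eq_comm] at hy
    exact (div_ne_zero (by simp [hz]) (by simp [hz])) hy
  rw [eq_div_iff (by simp [hz])] at hy
  have hw : ∀ i, (![y, z 1 / y ^ 4, z 2 * y ^ 16 / z 1 ^ 4, z 3 * z 1 ^ 16 / (z 2 ^ 4 * y ^ 64),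
    z 4 * z 2 ^ 16 * y ^ 256 / (z 3 ^ 4 * z 1 ^ 64)] : Fin 5 → ℂ) i ≠ 0 := by
    intro i
    fin_cases i <;> simp [hz, hy0]
  refine ⟨_, hw, ?_⟩
  funext i
  fin_cases i <;> simp [monMap]
  · field_simp
    linear_combination hy
  · field_simp
  · field_simp
  · field_simp
  · field_simp
  · field_simp
    refine mul_left_cancel₀ (mul_ne_zero h2 h4) ?_
    linear_combination congrArg (· ^ 5) hy + z 1 ^ 255 * z 3 ^ 15 * h

/-- The fibres of `monMap` on the torus, up to scalars, are the orbits of the matrices `twist wt ε`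
with `ε^205 = 1`. -/
theorem exists_twist_of_monMap_eq {x y : Fin 5 → ℂ} (hx : ∀ i, x i ≠ 0) (hy : ∀ i, y i ≠ 0)
    {r : ℂ} (hr : r ≠ 0) (h : monMap y = r • monMap x) :
    ∃ (u : ℂˣ) (ε : ℂˣ), ε ^ 205 = 1 ∧ ∀ i, y i = u * (twist wt ε i * x i) := by
  obtain ⟨μ, rfl⟩ := IsAlgClosed.exists_pow_nat_eq r (n := 5) (by norm_num)
  have hμ : μ ≠ 0 := fun h0 => hr (by simp [h0])
  have hc : ∀ i, ∃ c : ℂˣ, y i = μ * (c * x i) := fun i =>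
    ⟨Units.mk0 (y i / (μ * x i)) (div_ne_zero (hy i) (mul_ne_zero hμ (hx i))), by
      have := hx i
      simp
      field_simp⟩
  choose c hc using hc
  have hmon : monMap (fun i => (c i : ℂ) * x i) = monMap x := by
    have h1 : y = fun i => μ * (c i * x i) := funext hc
    rw [h1, monMap_smul] at h
    exact smul_right_injective _ (pow_ne_zero 5 hμ) h
  -- on the torus the monomials are multiplicative, so they take the value `1` at `c`
  have key : ∀ a b : Fin 5, (c a * x a) ^ 4 * (c b * x b) = x a ^ 4 * x b → c b = c a ^ (-4 : ℤ) := by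
    intro a b hab
    rw [zpow_neg, eq_inv_iff_mul_eq_one, zpow_ofNat]
    refine Units.ext (mul_right_cancel₀ (mul_ne_zero (pow_ne_zero 4 (hx a)) (hx b)) ?_)
    push_cast
    linear_combination hab
  have h1 := key 0 1 (by simpa [monMap] using congrFun hmon 1)
  have h2 := key 1 2 (by simpa [monMap] using congrFun hmon 2)
  have h3 := key 2 3 (by simpa [monMap] using congrFun hmon 3)
  have h4 := key 3 4 (by simpa [monMap] using congrFun hmon 4)
  rw [h1, ← zpow_mul] at h2
  rw [h2, ← zpow_mul] at h3
  rw [h3, ← zpow_mul] at h4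
  have h0 : c 0 * c 1 * c 2 * c 3 * c 4 = 1 := by
    have h5 := congrFun hmon 0
    simp [monMap] at h5
    refine Units.ext (mul_right_cancel₀ (b := x 0 * x 1 * x 2 * x 3 * x 4) (by simp [hx]) ?_)
    push_cast
    linear_combination h5
  refine ⟨Units.mk0 μ hμ, c 0, ?_, fun i => ?_⟩
  · rw [h1, h2, h3, h4] at h0
    nth_rewrite 1 [← zpow_one (c 0)] at h0
    simp only [← zpow_add] at h0
    exact_mod_cast h0
  · rw [hc i]
    have : c i = twist wt (c 0) i := by
      fin_cases i <;> simp [twist, wt]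
      · exact h1
      · exact h2
      · exact h3
      · exact h4
    rw [← this]
    rfl

/-- A Laurent monomial of weight `c + 205 s` is `x₁^c` times a Laurent monomial in `monMap`, because
`x₂ = z₁ x₁⁻⁴`, `x₃ = z₂ x₂⁻⁴`, `x₄ = z₃ x₃⁻⁴`, `x₅ = z₄ x₄⁻⁴` and
`x₁^205 = z₀ z₁^51 z₂^{-13} z₃^3 z₄^{-1}`. -/
theorem monomial_identity {v : Fin 5 → ℂ} (hv : ∀ i, v i ≠ 0) (m : Fin 5 → ℤ) (c s : ℤ)
    (h : m 0 - 4 * m 1 + 16 * m 2 - 64 * m 3 + 256 * m 4 = c + 205 * s) :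
    v 0 ^ m 0 * v 1 ^ m 1 * v 2 ^ m 2 * v 3 ^ m 3 * v 4 ^ m 4 =
      v 0 ^ c * (monMap v 0 ^ s * monMap v 1 ^ (m 1 - 4 * m 2 + 16 * m 3 - 64 * m 4 + 51 * s) *
        monMap v 2 ^ (m 2 - 4 * m 3 + 16 * m 4 - 13 * s) * monMap v 3 ^ (m 3 - 4 * m 4 + 3 * s) *
        monMap v 4 ^ (m 4 - s)) := by
  have k : ∀ i (a b : ℤ), v i ^ (a + b) = v i ^ a * v i ^ b := fun i a b => zpow_add₀ (hv i) a b
  have e0 : m 0 = c + s + 4 * (m 1 - 4 * m 2 + 16 * m 3 - 64 * m 4 + 51 * s) := by linarith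
  have e1 : m 1 = s + (m 1 - 4 * m 2 + 16 * m 3 - 64 * m 4 + 51 * s) +
    4 * (m 2 - 4 * m 3 + 16 * m 4 - 13 * s) := by ring
  have e2 : m 2 = s + (m 2 - 4 * m 3 + 16 * m 4 - 13 * s) + 4 * (m 3 - 4 * m 4 + 3 * s) := by ring
  have e3 : m 3 = s + (m 3 - 4 * m 4 + 3 * s) + 4 * (m 4 - s) := by ring
  have e4 : m 4 = s + (m 4 - s) := by ring
  have f0 := k 0 (c + s) (4 * (m 1 - 4 * m 2 + 16 * m 3 - 64 * m 4 + 51 * s))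
  have f1 := k 1 (s + (m 1 - 4 * m 2 + 16 * m 3 - 64 * m 4 + 51 * s))
    (4 * (m 2 - 4 * m 3 + 16 * m 4 - 13 * s))
  have f2 := k 2 (s + (m 2 - 4 * m 3 + 16 * m 4 - 13 * s)) (4 * (m 3 - 4 * m 4 + 3 * s))
  have f3 := k 3 (s + (m 3 - 4 * m 4 + 3 * s)) (4 * (m 4 - s))
  have f4 := k 4 s (m 4 - s)
  rw [← e0, k] at f0
  rw [← e1, k] at f1
  rw [← e2, k] at f2
  rw [← e3, k] at f3
  rw [← e4] at f4
  rw [f0, f1, f2, f3, f4]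
  simp only [monMap, Matrix.cons_val, mul_zpow, ← zpow_natCast, ← zpow_mul]
  push_cast
  ring

/-! ### Descent of polynomials along the monomial map -/

theorem sum_eq_of_isHomogeneous {ι : Type} [Fintype ι] {k : ℕ} {R : MvPolynomial ι ℂ}
    (hR : R.IsHomogeneous k) {m : ι →₀ ℕ} (hm : m ∈ R.support) : ∑ i, m i = k := by
  have := hR (MvPolynomial.mem_support_iff.mp hm)
  rw [Finsupp.weight_apply, Finsupp.sum_fintype _ _ (by simp)] at this
  simpa using this

theorem exists_descend_monomial (k c : ℕ) (m : Fin 5 →₀ ℕ) (a : ℂ) (hm : ∑ i, m i = k)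
    (hw : ((∑ i, wt i * m i : ℤ) : ZMod 205) = c) :
    ∃ N₀ : ℕ, ∀ N ≥ N₀, ∀ D : ℕ, 5 * D + c = k + 30 * N →
      ∃ Q : MvPolynomial (Fin 6) ℂ, Q.IsHomogeneous D ∧ ∀ v : Fin 5 → ℂ, (∀ i, v i ≠ 0) →
        (MvPolynomial.monomial m a).eval v * (∏ i, monMap v i) ^ N =
          v 0 ^ c * Q.eval (monMap v) := by
  have hw' : ((∑ i, wt i * m i - c : ℤ) : ZMod 205) = 0 := by
    rw [Int.cast_sub, hw]
    simp
  rw [ZMod.intCast_zmod_eq_zero_iff_dvd] at hw'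
  obtain ⟨s, hs⟩ := hw'
  simp [Fin.sum_univ_five, wt] at hs hm
  -- the exponents of `monomial_identity`; multiplying by `(z₀⋯z₅)^N` makes them nonnegative
  let β : Fin 6 → ℤ := ![s, m 1 - 4 * m 2 + 16 * m 3 - 64 * m 4 + 51 * s,
    m 2 - 4 * m 3 + 16 * m 4 - 13 * s, m 3 - 4 * m 4 + 3 * s, m 4 - s, 0]
  refine ⟨∑ i, (β i).natAbs, fun N hN D hD => ?_⟩
  have hβ : ∀ i, 0 ≤ β i + N := fun i => by
    have : (β i).natAbs ≤ ∑ i, (β i).natAbs :=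
      Finset.single_le_sum (f := fun i => (β i).natAbs) (fun _ _ => Nat.zero_le _)
        (Finset.mem_univ i)
    omega
  let γ : Fin 6 → ℕ := fun i => (β i + N).toNat
  have hγ : ∀ i, (γ i : ℤ) = β i + N := fun i => Int.toNat_of_nonneg (hβ i)
  refine ⟨MvPolynomial.monomial (Finsupp.equivFunOnFinite.symm γ) a,
    MvPolynomial.isHomogeneous_monomial a ?_, fun v hv => ?_⟩
  · rw [Finsupp.degree_eq_sum]
    have h0 := hγ 0
    have h1 := hγ 1
    have h2 := hγ 2
    have h3 := hγ 3
    have h4 := hγ 4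
    have h5 := hγ 5
    simp [β] at h0 h1 h2 h3 h4 h5
    simp [Fin.sum_univ_six]
    omega
  · rw [MvPolynomial.eval_monomial, MvPolynomial.eval_monomial, Finsupp.prod_fintype _ _ (by simp),
      Finsupp.prod_fintype _ _ (by simp)]
    have key := monomial_identity hv (fun i => m i) c s (by linarith)
    have hz : ∀ i, monMap v i ^ γ i = monMap v i ^ β i * monMap v i ^ N := fun i => by
      rw [← zpow_natCast, hγ, zpow_add₀ (monMap_ne_zero hv i), zpow_natCast]
    simp only [Finsupp.equivFunOnFinite_symm_apply_apply, hz, Finset.prod_mul_distrib,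
      Finset.prod_pow]
    have hβ' : ∏ i, monMap v i ^ β i = monMap v 0 ^ s *
        monMap v 1 ^ (m 1 - 4 * m 2 + 16 * m 3 - 64 * m 4 + 51 * s : ℤ) *
        monMap v 2 ^ (m 2 - 4 * m 3 + 16 * m 4 - 13 * s : ℤ) *
        monMap v 3 ^ (m 3 - 4 * m 4 + 3 * s : ℤ) * monMap v 4 ^ (m 4 - s : ℤ) := by
      simp [Fin.prod_univ_six, β]
    rw [hβ', Fin.prod_univ_five]
    simp only [zpow_natCast] at key
    rw [key]
    ring

/-- A weight part of a homogeneous polynomial is, on the torus and up to a factor depending only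
on the degree and the weight, a homogeneous polynomial in the monomials `monPoly`. -/
theorem exists_descend {k : ℕ} (c : ℕ) {R : MvPolynomial (Fin 5) ℂ} (hR : R.IsHomogeneous k) :
    ∃ N₀ : ℕ, ∀ N ≥ N₀, ∀ D : ℕ, 5 * D + c = k + 30 * N →
      ∃ Q : MvPolynomial (Fin 6) ℂ, Q.IsHomogeneous D ∧ ∀ v : Fin 5 → ℂ, (∀ i, v i ≠ 0) →
        (weightPart 205 wt c R).eval v * (∏ i, monMap v i) ^ N =
          v 0 ^ c * Q.eval (monMap v) := by
  rw [R.as_sum]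
  refine Finset.sum_induction _ (fun R : MvPolynomial (Fin 5) ℂ => ∃ N₀ : ℕ, ∀ N ≥ N₀, ∀ D : ℕ,
      5 * D + c = k + 30 * N → ∃ Q : MvPolynomial (Fin 6) ℂ, Q.IsHomogeneous D ∧
        ∀ v : Fin 5 → ℂ, (∀ i, v i ≠ 0) → (weightPart 205 wt c R).eval v *
          (∏ i, monMap v i) ^ N = v 0 ^ c * Q.eval (monMap v)) ?_ ?_ ?_
  · rintro P Q ⟨N₁, h₁⟩ ⟨N₂, h₂⟩
    refine ⟨max N₁ N₂, fun N hN D hD => ?_⟩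
    obtain ⟨P', hP', hP⟩ := h₁ N (le_of_max_le_left hN) D hD
    obtain ⟨Q', hQ', hQ⟩ := h₂ N (le_of_max_le_right hN) D hD
    refine ⟨P' + Q', hP'.add hQ', fun v hv => ?_⟩
    simp only [map_add, add_mul, mul_add, hP v hv, hQ v hv]
  · exact ⟨0, fun N _ D _ => ⟨0, MvPolynomial.isHomogeneous_zero _ _ _, by simp⟩⟩
  · intro m hm
    rw [weightPart_monomial]
    split_ifs with h
    · exact exists_descend_monomial k c m _ (sum_eq_of_isHomogeneous hR hm) h
    · exact ⟨0, fun N _ D _ => ⟨0, MvPolynomial.isHomogeneous_zero _ _ _, by simp⟩⟩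

/-- Weight and degree are congruent modulo `5`. -/
theorem modEq_of_eval_weightPart_ne_zero {k : ℕ} {c : ZMod 205} {R : MvPolynomial (Fin 5) ℂ}
    (hR : R.IsHomogeneous k) {v : Fin 5 → ℂ} (h : (weightPart 205 wt c R).eval v ≠ 0) :
    (5 : ℤ) ∣ k - c.val := by
  obtain ⟨m, hm⟩ : ∃ m, MvPolynomial.coeff m (weightPart 205 wt c R) ≠ 0 := by
    by_contra! h0
    exact h (by rw [(MvPolynomial.ext _ 0 (by simpa using h0) : weightPart 205 wt c R = 0)]; simp)
  rw [MvPolynomial.coeff_weightedHomogeneousComponent, weight_cast] at hm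
  have h1 : ((∑ i, wt i * m i : ℤ) : ZMod 205) = c := by
    by_contra h1
    exact hm (if_neg h1)
  have h2 : m ∈ R.support := by
    rw [MvPolynomial.mem_support_iff]
    intro h2
    simp [h2] at hm
  have h3 := sum_eq_of_isHomogeneous hR h2
  have h4 : ((∑ i, wt i * m i - c.val : ℤ) : ZMod 205) = 0 := by
    rw [Int.cast_sub, h1]
    simp
  rw [ZMod.intCast_zmod_eq_zero_iff_dvd] at h4
  generalize c.val = e at h4 ⊢
  simp [Fin.sum_univ_five, wt] at h3 h4
  omega

/-- Two polynomials of the same degree and a common weight `c` occurring in the second one: the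
quotient of their weight parts descends to a quotient of homogeneous polynomials. -/
theorem exists_descend_pair {k : ℕ} {c : ZMod 205} {P Q : MvPolynomial (Fin 5) ℂ}
    (hP : P.IsHomogeneous k) (hQ : Q.IsHomogeneous k) {v₀ : Fin 5 → ℂ}
    (h : (weightPart 205 wt c Q).eval v₀ ≠ 0) :
    ∃ (N D : ℕ) (P' Q' : MvPolynomial (Fin 6) ℂ), P'.IsHomogeneous D ∧ Q'.IsHomogeneous D ∧
      ∀ v : Fin 5 → ℂ, (∀ i, v i ≠ 0) →
        (weightPart 205 wt c P).eval v * (∏ i, monMap v i) ^ N =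
          v 0 ^ c.val * P'.eval (monMap v) ∧
        (weightPart 205 wt c Q).eval v * (∏ i, monMap v i) ^ N =
          v 0 ^ c.val * Q'.eval (monMap v) := by
  obtain ⟨N₁, h₁⟩ := exists_descend c.val hP
  obtain ⟨N₂, h₂⟩ := exists_descend c.val hQ
  have h5 := modEq_of_eval_weightPart_ne_zero hQ h
  have hc := ZMod.val_lt c
  let N := N₁ + N₂ + 7
  have hD : 5 * ((k + 30 * N - c.val) / 5) + c.val = k + 30 * N := by omega
  obtain ⟨P', hP', hP''⟩ := h₁ N (by omega) _ hD
  obtain ⟨Q', hQ', hQ''⟩ := h₂ N (by omega) _ hD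
  rw [ZMod.natCast_zmod_val] at hP'' hQ''
  exact ⟨N, _, P', Q', hP', hQ', fun v hv => ⟨hP'' v hv, hQ'' v hv⟩⟩

/-! ### The quotient map -/

/-- The set of points of the mirror variety. -/
def mirrorSet (t : ℂ) : Set (ℙ ℂ (Fin 6 → ℂ)) :=
  zeroLocus
    {∑ i : Fin 5, MvPolynomial.X i.succ -
        MvPolynomial.C ((5 : ℕ) * t) * MvPolynomial.X (0 : Fin (5 + 1)),
      MvPolynomial.X (0 : Fin (5 + 1)) ^ 5 - ∏ i : Fin 5, MvPolynomial.X i.succ}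

theorem mirrorVariety_five (t : ℂ) : mirrorVariety 5 t = projVariety (mirrorSet t) := rfl

theorem mk_mem_mirrorSet_iff {t : ℂ} {z : Fin 6 → ℂ} (hz : z ≠ 0) :
    Projectivization.mk ℂ z hz ∈ mirrorSet t ↔
      z 1 + z 2 + z 3 + z 4 + z 5 - 5 * t * z 0 = 0 ∧ z 0 ^ 5 - z 1 * z 2 * z 3 * z 4 * z 5 = 0 := by
  have hX := fun j : Fin 6 => MvPolynomial.isHomogeneous_X ℂ j
  have h1 : (∑ i : Fin 5, MvPolynomial.X i.succ -
      MvPolynomial.C ((5 : ℕ) * t) * MvPolynomial.X (0 : Fin (5 + 1))).IsHomogeneous 1 :=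
    (MvPolynomial.IsHomogeneous.sum _ _ _ fun i _ => hX i.succ).sub ((hX 0).C_mul _)
  have h2 : (MvPolynomial.X (0 : Fin (5 + 1)) ^ 5 -
      ∏ i : Fin 5, MvPolynomial.X i.succ : MvPolynomial (Fin 6) ℂ).IsHomogeneous 5 := by
    refine MvPolynomial.IsHomogeneous.sub ((hX 0).pow 5) ?_
    have := MvPolynomial.IsHomogeneous.prod (R := ℂ) Finset.univ
      (fun j : Fin 5 => (MvPolynomial.X j.succ : MvPolynomial (Fin 6) ℂ)) (fun _ => 1)
      fun j _ => MvPolynomial.isHomogeneous_X _ j.succ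
    simpa using this
  simp only [mirrorSet, zeroLocus, Set.mem_insert_iff, Set.mem_singleton_iff, Set.mem_ofPred_eq,
    forall_eq_or_imp, forall_eq]
  rw [eval_rep_mk_eq_zero hz h1, eval_rep_mk_eq_zero hz h2]
  simp [Fin.sum_univ_five, Fin.prod_univ_five]

theorem rep_mirrorSet {t : ℂ} {p : ℙ ℂ (Fin 6 → ℂ)} (hp : p ∈ mirrorSet t) :
    p.rep 1 + p.rep 2 + p.rep 3 + p.rep 4 + p.rep 5 - 5 * t * p.rep 0 = 0 ∧
      p.rep 0 ^ 5 - p.rep 1 * p.rep 2 * p.rep 3 * p.rep 4 * p.rep 5 = 0 := by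
  rw [← mk_mem_mirrorSet_iff p.rep_nonzero, p.mk_rep]
  exact hp

theorem eval_dworkPoly_eq (t : ℂ) (v : Fin 5 → ℂ) : (dworkPoly secondFamily.A t).eval v =
    monMap v 1 + monMap v 2 + monMap v 3 + monMap v 4 + monMap v 5 - 5 * t * monMap v 0 := by
  rw [eval_dworkPoly_secondFamily]
  simp [monMap]

theorem mk_mem_dworkSet_iff {t : ℂ} {v : Fin 5 → ℂ} (hv : v ≠ 0) :
    Projectivization.mk ℂ v hv ∈ dworkSet secondFamily.A t ↔
      (dworkPoly secondFamily.A t).eval v = 0 := by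
  simp only [dworkSet, zeroLocus, Set.mem_singleton_iff, Set.mem_ofPred_eq, forall_eq]
  exact eval_rep_mk_eq_zero hv (dworkPoly_secondFamily_isHomogeneous t)

/-- The points of `X_{A,t}` with nonzero coordinates. -/
def torusPart (t : ℂ) : Set (dworkSet secondFamily.A t) :=
  {p | (monPoly 0).eval p.1.rep ≠ 0}

/-- The points of the mirror variety with nonzero coordinates; by `z₀⁵ = z₁z₂z₃z₄z₅` the condition
`z₀ ≠ 0` suffices. -/
def mirrorTorus (t : ℂ) : Set (mirrorSet t) :=
  {p | (MvPolynomial.X 0 : MvPolynomial (Fin 6) ℂ).eval p.1.rep ≠ 0}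

theorem mem_torusPart {t : ℂ} {p : dworkSet secondFamily.A t} :
    p ∈ torusPart t ↔ ∀ i, p.1.rep i ≠ 0 := by
  rw [torusPart, Set.mem_ofPred_eq, eval_monPoly]
  exact monMap_zero_ne_zero_iff

theorem isOpen_torusPart (t : ℂ) : IsOpen (torusPart t) :=
  (isOpen_principal (monPoly_isHomogeneous 0)).preimage continuous_subtype_val

theorem isOpen_mirrorTorus (t : ℂ) : IsOpen (mirrorTorus t) :=
  (isOpen_principal (MvPolynomial.isHomogeneous_X ℂ 0)).preimage continuous_subtype_val

theorem monMap_ne_zero' {v : Fin 5 → ℂ} (hv : ∀ i, v i ≠ 0) : monMap v ≠ 0 :=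
  fun h => monMap_ne_zero hv 0 (congrFun h 0)

theorem mk_monMap_mem {t : ℂ} {p : dworkSet secondFamily.A t} (hp : ∀ i, p.1.rep i ≠ 0) :
    Projectivization.mk ℂ (monMap p.1.rep) (monMap_ne_zero' hp) ∈ mirrorSet t := by
  rw [mk_mem_mirrorSet_iff, ← eval_dworkPoly_eq]
  refine ⟨p.2 _ rfl, ?_⟩
  simp [monMap]
  ring

open Classical in
/-- The map `x ↦ (x₁x₂x₃x₄x₅ : x₁⁴x₂ : … : x₅⁴x₁)` from `X_{A,t}` to the mirror variety, extended by
a constant to the points with a vanishing coordinate. -/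
noncomputable def quotMap (t : ℂ) (p : dworkSet secondFamily.A t) : mirrorSet t :=
  if h : ∀ i, p.1.rep i ≠ 0 then ⟨_, mk_monMap_mem h⟩
  else ⟨_, mk_monMap_mem (exists_torus_point t).choose_spec⟩

theorem quotMap_of_mem {t : ℂ} {p : dworkSet secondFamily.A t} (hp : p ∈ torusPart t) :
    (quotMap t p).1 =
      Projectivization.mk ℂ (monMap p.1.rep) (monMap_ne_zero' (mem_torusPart.mp hp)) := by
  rw [quotMap, dif_pos (mem_torusPart.mp hp)]

theorem exists_eval_quotMap {t : ℂ} {p : dworkSet secondFamily.A t} (hp : p ∈ torusPart t) :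
    ∃ u : ℂˣ, ∀ (k : ℕ) (P : MvPolynomial (Fin 6) ℂ), P.IsHomogeneous k →
      P.eval (quotMap t p).1.rep = (u : ℂ) ^ k * P.eval (monMap p.1.rep) := by
  rw [quotMap_of_mem hp]
  exact exists_eval_rep_mk _ _

theorem eval_quotMap_ne_zero_iff {t : ℂ} {p : dworkSet secondFamily.A t} (hp : p ∈ torusPart t)
    {k : ℕ} {P : MvPolynomial (Fin 6) ℂ} (hP : P.IsHomogeneous k) :
    P.eval (quotMap t p).1.rep ≠ 0 ↔ P.eval (monMap p.1.rep) ≠ 0 := by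
  obtain ⟨u, hu⟩ := exists_eval_quotMap hp
  rw [hu k P hP, mul_ne_zero_iff, and_iff_right (pow_ne_zero _ u.ne_zero)]

theorem quotMap_eq_iff {t : ℂ} {p q : dworkSet secondFamily.A t} (hp : p ∈ torusPart t)
    (hq : q ∈ torusPart t) :
    quotMap t p = quotMap t q ↔ ∃ r : ℂ, r • monMap q.1.rep = monMap p.1.rep := by
  rw [Subtype.ext_iff, quotMap_of_mem hp, quotMap_of_mem hq]
  exact Projectivization.mk_eq_mk_iff' ℂ _ _ _ _

theorem mapsTo_quotMap (t : ℂ) : Set.MapsTo (quotMap t) (torusPart t) (mirrorTorus t) := by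
  intro p hp
  rw [mirrorTorus, Set.mem_ofPred_eq, eval_quotMap_ne_zero_iff hp (MvPolynomial.isHomogeneous_X ℂ 0),
    MvPolynomial.eval_X]
  exact monMap_ne_zero (mem_torusPart.mp hp) 0

theorem surjOn_quotMap (t : ℂ) : Set.SurjOn (quotMap t) (torusPart t) (mirrorTorus t) := by
  intro z hz
  obtain ⟨hz1, hz2⟩ := rep_mirrorSet z.2
  have hz0 : z.1.rep 0 ≠ 0 := by simpa [mirrorTorus] using hz
  have hzn : ∀ i, z.1.rep i ≠ 0 := by
    have h : z.1.rep 1 * z.1.rep 2 * z.1.rep 3 * z.1.rep 4 * z.1.rep 5 ≠ 0 := by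
      rw [← sub_eq_zero.mp hz2]
      exact pow_ne_zero 5 hz0
    simp only [mul_ne_zero_iff] at h
    obtain ⟨⟨⟨⟨h1, h2⟩, h3⟩, h4⟩, h5⟩ := h
    intro i
    fin_cases i <;> assumption
  obtain ⟨v, hv, hvz⟩ := exists_monMap_eq hzn (sub_eq_zero.mp hz2)
  have hv0 : v ≠ 0 := fun h => hv 0 (congrFun h 0)
  obtain ⟨u, hu⟩ := Projectivization.exists_smul_eq_mk_rep ℂ v hv0
  have hu' : (Projectivization.mk ℂ v hv0).rep = fun i => (u : ℂ) * v i := hu.symm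
  let p : dworkSet secondFamily.A t := ⟨Projectivization.mk ℂ v hv0, by
    rw [mk_mem_dworkSet_iff, eval_dworkPoly_eq, hvz]
    exact hz1⟩
  have hp : p ∈ torusPart t := by
    rw [mem_torusPart]
    intro i
    change (Projectivization.mk ℂ v hv0).rep i ≠ 0
    rw [hu']
    exact mul_ne_zero u.ne_zero (hv i)
  refine ⟨p, hp, Subtype.ext ?_⟩
  rw [quotMap_of_mem hp]
  conv_rhs => rw [← z.1.mk_rep]
  rw [Projectivization.mk_eq_mk_iff']
  refine ⟨(u : ℂ) ^ 5, ?_⟩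
  change _ = monMap (Projectivization.mk ℂ v hv0).rep
  rw [hu', monMap_smul, hvz]

/-! ### The action of `H_A` -/

theorem pow_val_eq_zpow {n : ℕ} [NeZero n] {ζ : ℂˣ} (hζ : ζ ^ n = 1) (e : ℤ) :
    ζ ^ (e : ZMod n).val = ζ ^ e := by
  rw [← zpow_natCast, ZMod.val_intCast]
  conv_rhs => rw [← Int.emod_add_mul_ediv e n, zpow_add, zpow_mul, zpow_natCast, hζ, one_zpow, mul_one]

theorem zetaPow_eq_twist {ζ : ℂˣ} (hζ : ζ ^ 1025 = 1) {a : Fin 5 → ZMod 1025} {j : ℕ}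
    (ha : rowForm a = 5 * j) :
    zetaPow ζ (mulB secondFamily.B a) = twist wt ((ζ ^ 5) ^ j) := by
  funext i
  have h : mulB secondFamily.B a i = ((wt i * (5 * j) : ℤ) : ZMod 1025) := by
    rw [mulB_secondFamily, ha]
    push_cast
    rfl
  rw [twist, ← pow_mul, ← zpow_natCast, ← zpow_mul]
  refine (congrArg (fun x : ZMod 1025 => ζ ^ x.val) h).trans ?_
  refine (pow_val_eq_zpow hζ _).trans ?_
  congr 1
  push_cast
  ring

theorem exists_twist_of_mem_range {ζ : ℂˣ} (hζ : ζ ^ 1025 = 1) {t : ℂ}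
    {h : Aut (dworkVariety secondFamily.A t)} (hh : h ∈ (cyclicHom hζ t).range) :
    ∃ j : ℕ, ∀ p : dworkSet secondFamily.A t,
      (h.1 p).1 = diagMap (twist wt ((ζ ^ 5) ^ j)) p.1 := by
  obtain ⟨x, rfl⟩ := hh
  obtain ⟨a, rfl⟩ := QuotientAddGroup.mk_surjective (Multiplicative.toAdd x)
  obtain ⟨j, hj⟩ := exists_rowForm_eq a
  refine ⟨j, fun p => ?_⟩
  rw [← zetaPow_eq_twist hζ hj]
  exact cyclicHom_apply hζ t a p

theorem exists_mem_range_of_twist {ζ : ℂˣ} (hζ : ζ ^ 1025 = 1) (t : ℂ) (j : ℕ) :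
    ∃ h ∈ (cyclicHom hζ t).range, ∀ p : dworkSet secondFamily.A t,
      (h.1 p).1 = diagMap (twist wt ((ζ ^ 5) ^ j)) p.1 := by
  let a : exponents 5 1025 := ⟨Pi.single 4 (5 * j), j, by simp⟩
  have ha : rowForm a.1 = 5 * j := by simp [a, rowForm]
  refine ⟨_, ⟨Multiplicative.ofAdd (QuotientAddGroup.mk a), rfl⟩, fun p => ?_⟩
  rw [← zetaPow_eq_twist hζ ha]
  exact cyclicHom_apply hζ t a p

theorem pow_five_pow_205 {ζ : ℂˣ} (hζ : ζ ^ 1025 = 1) (j : ℕ) : ((ζ ^ 5) ^ j) ^ 205 = 1 := by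
  rw [← pow_mul, ← pow_mul, show 5 * (j * 205) = 1025 * j by ring, pow_mul, hζ, one_pow]

theorem mem_torusPart_of_mem_range {ζ : ℂˣ} (hζ : ζ ^ 1025 = 1) {t : ℂ}
    {h : Aut (dworkVariety secondFamily.A t)} (hh : h ∈ (cyclicHom hζ t).range)
    {p : dworkSet secondFamily.A t} (hp : p ∈ torusPart t) : h.1 p ∈ torusPart t := by
  obtain ⟨j, hj⟩ := exists_twist_of_mem_range hζ hh
  obtain ⟨u, hu⟩ := exists_rep_diagMap (twist wt ((ζ ^ 5) ^ j)) p.1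
  refine mem_torusPart.mpr fun i => ?_
  rw [mem_torusPart] at hp
  rw [hj, hu]
  exact mul_ne_zero u.ne_zero (mul_ne_zero (Units.ne_zero _) (hp i))

theorem quotMap_of_mem_range {ζ : ℂˣ} (hζ : ζ ^ 1025 = 1) {t : ℂ}
    {h : Aut (dworkVariety secondFamily.A t)} (hh : h ∈ (cyclicHom hζ t).range)
    {p : dworkSet secondFamily.A t} (hp : p ∈ torusPart t) :
    quotMap t (h.1 p) = quotMap t p := by
  refine (quotMap_eq_iff (mem_torusPart_of_mem_range hζ hh hp) hp).mpr ?_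
  obtain ⟨j, hj⟩ := exists_twist_of_mem_range hζ hh
  obtain ⟨u, hu⟩ := exists_rep_diagMap (twist wt ((ζ ^ 5) ^ j)) p.1
  refine ⟨(u : ℂ) ^ 5, ?_⟩
  rw [hj, hu, monMap_smul, monMap_twist (pow_five_pow_205 hζ j)]

theorem isPrimitiveRoot_pow_five {ζ : ℂˣ} (hζ : IsPrimitiveRoot ζ 1025) :
    IsPrimitiveRoot (ζ ^ 5) 205 :=
  hζ.pow (by norm_num) (by norm_num)

/-- The fibres of `quotMap` on the torus are the orbits of `H_A`. -/
theorem exists_mem_range_of_quotMap_eq {ζ : ℂˣ} (hζ : IsPrimitiveRoot ζ 1025) {t : ℂ}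
    {p q : dworkSet secondFamily.A t} (hp : p ∈ torusPart t) (hq : q ∈ torusPart t)
    (hpq : quotMap t p = quotMap t q) : ∃ h ∈ (cyclicHom hζ.pow_eq_one t).range, h.1 p = q := by
  obtain ⟨r, hr⟩ := (quotMap_eq_iff hq hp).mp hpq.symm
  rw [mem_torusPart] at hp hq
  have hr0 : r ≠ 0 := by
    rintro rfl
    rw [zero_smul] at hr
    exact monMap_ne_zero' hq hr.symm
  obtain ⟨u, ε, hε, hu⟩ := exists_twist_of_monMap_eq hp hq hr0 hr.symm
  obtain ⟨j, -, hjε⟩ := (IsPrimitiveRoot.coe_units_iff.mpr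
    (isPrimitiveRoot_pow_five hζ)).eq_pow_of_pow_eq_one (congrArg Units.val hε)
  obtain rfl : (ζ ^ 5) ^ j = ε := Units.ext hjε
  obtain ⟨h, hh, hj⟩ := exists_mem_range_of_twist hζ.pow_eq_one t j
  refine ⟨h, hh, Subtype.ext ?_⟩
  rw [hj]
  conv_lhs => rw [← p.1.mk_rep]
  conv_rhs => rw [← q.1.mk_rep]
  rw [diagMap, Projectivization.map_mk, Projectivization.mk_eq_mk_iff']
  refine ⟨(u : ℂ)⁻¹, ?_⟩
  funext i
  rw [Pi.smul_apply, hu i, smul_eq_mul, inv_mul_cancel_left₀ u.ne_zero]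
  rfl

/-! ### Density of the torus parts -/

theorem dense_torusPart (t : ℂ) : Dense (torusPart t) := by
  refine dense_principal _ fun k P hP h p hp => ?_
  have hF : ∀ q ∈ dworkSet secondFamily.A t, (dworkPoly secondFamily.A t).eval q.rep = 0 :=
    fun q hq => hq _ rfl
  refine eval_eq_zero_of_eval_eq_zero (F := dworkPoly secondFamily.A t) (M := monPoly 0) ?_ ?_
    (hF p hp)
  · have hX : ∀ (i : Fin 5) (Q : MvPolynomial (Fin 5) ℂ),
        dworkPoly secondFamily.A t ∣ MvPolynomial.X i * Q → dworkPoly secondFamily.A t ∣ Q := by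
      intro i
      refine dvd_of_dvd_X_mul (v := Function.update 1 i 0) (by simp) ?_
      rw [eval_dworkPoly_secondFamily]
      fin_cases i <;> simp [Function.update] <;> norm_num
    intro Q hQ
    simp only [monPoly, Matrix.cons_val_zero, mul_assoc] at hQ
    exact hX 4 _ (hX 3 _ (hX 2 _ (hX 1 _ (hX 0 _ hQ))))
  · intro v hv hM
    rw [eval_monPoly] at hM
    have hv0 : v ≠ 0 := fun h0 => monMap_zero_ne_zero_iff.mp hM 0 (congrFun h0 0)
    rw [← eval_rep_mk_eq_zero hv0 hP]
    refine h _ ((mk_mem_dworkSet_iff hv0).mpr hv) ?_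
    rw [Ne, eval_rep_mk_eq_zero hv0 (monPoly_isHomogeneous 0), eval_monPoly]
    exact hM

theorem dense_mirrorTorus (t : ℂ) : Dense (mirrorTorus t) := by
  refine dense_principal _ fun k P hP h p hp => ?_
  -- the hyperplane section is eliminated by solving its equation for `z₅`
  let ℓ : MvPolynomial (Fin 5) ℂ := MvPolynomial.C (5 * t) * .X 0 - .X 1 - .X 2 - .X 3 - .X 4
  let σ : Fin 6 → MvPolynomial (Fin 5) ℂ := ![.X 0, .X 1, .X 2, .X 3, .X 4, ℓ]
  let G : MvPolynomial (Fin 5) ℂ := .X 0 ^ 5 - .X 1 * .X 2 * .X 3 * .X 4 * ℓ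
  let z : (Fin 5 → ℂ) → Fin 6 → ℂ := fun v =>
    ![v 0, v 1, v 2, v 3, v 4, 5 * t * v 0 - v 1 - v 2 - v 3 - v 4]
  have hσ : ∀ v, (MvPolynomial.aeval σ P).eval v = P.eval (z v) := by
    intro v
    have hσi : ∀ i, (σ i).eval v = z v i := fun i => by
      fin_cases i <;> simp [σ, z, ℓ]
    rw [eval_aeval, funext hσi]
  have hG : ∀ v, G.eval v =
      v 0 ^ 5 - v 1 * v 2 * v 3 * v 4 * (5 * t * v 0 - v 1 - v 2 - v 3 - v 4) := fun v => by
    simp [G, ℓ]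
  obtain ⟨h1, h2⟩ := rep_mirrorSet hp
  let w : Fin 5 → ℂ := ![p.rep 0, p.rep 1, p.rep 2, p.rep 3, p.rep 4]
  have hw5 : 5 * t * p.rep 0 - p.rep 1 - p.rep 2 - p.rep 3 - p.rep 4 = p.rep 5 := by
    linear_combination -h1
  have hw : z w = p.rep := by
    funext i
    fin_cases i <;> simp [z, w]
    exact hw5
  rw [← hw, ← hσ]
  refine eval_eq_zero_of_eval_eq_zero (F := G) (M := .X 0) ?_ ?_ ?_
  · refine dvd_of_dvd_X_mul (v := ![0, 1, 1, 1, 1]) (by simp) ?_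
    rw [hG]
    simp
    norm_num
  · intro v hv hM
    rw [MvPolynomial.eval_X] at hM
    have hv0 : z v ≠ 0 := fun h0 => hM (congrFun h0 0)
    rw [hσ, ← eval_rep_mk_eq_zero hv0 hP]
    refine h _ ((mk_mem_mirrorSet_iff hv0).mpr ?_) ?_
    · rw [hG] at hv
      simp [z]
      linear_combination hv
    · rw [Ne, eval_rep_mk_eq_zero hv0 (MvPolynomial.isHomogeneous_X ℂ 0), MvPolynomial.eval_X]
      exact hM
  · rw [hG]
    simp only [w, Matrix.cons_val, hw5]
    exact h2

/-! ### The quotient map is a geometric quotient on the torus -/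

theorem continuousOn_quotMap (t : ℂ) : ContinuousOn (quotMap t) (torusPart t) := by
  refine (continuousOn_open_iff (isOpen_torusPart t)).mpr ?_
  rintro _ ⟨V, hV, rfl⟩
  refine isOpen_iff_forall_mem_open.mpr fun p hp => ?_
  obtain ⟨k, R, hR, hRp, hRV⟩ := exists_principal_subset hV hp.2
  have hR' := hR.aeval monPoly monPoly_isHomogeneous
  refine ⟨torusPart t ∩ {q | (MvPolynomial.aeval monPoly R).eval q.1.rep ≠ 0}, ?_,
    (isOpen_torusPart t).inter ((isOpen_principal hR').preimage continuous_subtype_val), hp.1, ?_⟩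
  · rintro q ⟨hq, hqR⟩
    refine ⟨hq, hRV _ ?_⟩
    rw [eval_quotMap_ne_zero_iff hq hR, ← eval_aeval_monPoly]
    exact hqR
  · rw [Set.mem_ofPred_eq, eval_aeval_monPoly, ← eval_quotMap_ne_zero_iff hp.1 hR]
    exact hRp

theorem projRegularOn_comp_quotMap {t : ℂ} {V : Set (mirrorSet t)} {f : mirrorSet t → ℂ}
    (hf : ProjRegularOn V f) :
    ProjRegularOn (torusPart t ∩ quotMap t ⁻¹' V) (f ∘ quotMap t) := by
  rintro p ⟨hp, hpV⟩
  obtain ⟨W, hW, hpW, k, P, Q, hP, hQ, H⟩ := hf _ hpV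
  obtain ⟨l, R, hR, hRp, hRW⟩ := exists_principal_subset hW hpW
  refine ⟨{q | (MvPolynomial.aeval monPoly R).eval q.rep ≠ 0},
    isOpen_principal (hR.aeval monPoly monPoly_isHomogeneous), ?_, 5 * k, _, _,
    hP.aeval monPoly monPoly_isHomogeneous, hQ.aeval monPoly monPoly_isHomogeneous, ?_⟩
  · rw [Set.mem_ofPred_eq, eval_aeval_monPoly, ← eval_quotMap_ne_zero_iff hp hR]
    exact hRp
  · rintro q ⟨hq, hqV⟩ hqR
    rw [Set.mem_ofPred_eq, eval_aeval_monPoly, ← eval_quotMap_ne_zero_iff hq hR] at hqR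
    obtain ⟨h1, h2⟩ := H _ hqV (hRW _ hqR)
    obtain ⟨u, hu⟩ := exists_eval_quotMap hq
    rw [hu k Q hQ] at h1 h2
    rw [hu k P hP] at h2
    rw [eval_aeval_monPoly, eval_aeval_monPoly]
    refine ⟨right_ne_zero_of_mul h1, ?_⟩
    rw [Function.comp_apply, h2, mul_div_mul_left _ _ (pow_ne_zero _ u.ne_zero)]

/-- The map `quotMap` is open on the torus: a homogeneous `R` not vanishing at `p` has a weight part
not vanishing at `p`, and over the points where the corresponding polynomial on the mirror variety
does not vanish the fibre of `quotMap` meets the locus `R ≠ 0`. -/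
theorem isOpen_image_quotMap {ζ : ℂˣ} (hζ : IsPrimitiveRoot ζ 1025) (t : ℂ)
    {U : Set (dworkSet secondFamily.A t)} (hUS : U ⊆ torusPart t) (hU : IsOpen U) :
    IsOpen (quotMap t '' U) := by
  have hprim := isPrimitiveRoot_pow_five hζ
  obtain ⟨U, hU, rfl⟩ := hU
  refine isOpen_iff_forall_mem_open.mpr ?_
  rintro _ ⟨p, hp, rfl⟩
  obtain ⟨k, R, hR, hRp, hRU⟩ := exists_principal_subset hU hp
  obtain ⟨c, hc⟩ := exists_eval_weightPart_ne_zero (n := 205) wt hRp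
  obtain ⟨N, D, _, Q, _, hQ, H⟩ := exists_descend_pair hR hR hc
  have hQp : ∀ q ∈ torusPart t, (Q.eval (quotMap t q).1.rep ≠ 0 ↔
      (weightPart 205 wt c R).eval q.1.rep ≠ 0) := by
    intro q hq
    have hq' := mem_torusPart.mp hq
    rw [eval_quotMap_ne_zero_iff hq hQ]
    have h1 := (H _ hq').2
    have h2 : (∏ i, monMap q.1.rep i) ^ N ≠ 0 :=
      pow_ne_zero _ (Finset.prod_ne_zero_iff.mpr fun i _ => monMap_ne_zero hq' i)
    have h3 : q.1.rep 0 ^ c.val ≠ 0 := pow_ne_zero _ (hq' 0)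
    rw [← mul_ne_zero_iff_left h3, ← h1, mul_ne_zero_iff_right h2]
  refine ⟨mirrorTorus t ∩ {z | Q.eval z.1.rep ≠ 0}, ?_,
    (isOpen_mirrorTorus t).inter ((isOpen_principal hQ).preimage continuous_subtype_val),
    mapsTo_quotMap t (hUS hp), (hQp p (hUS hp)).mpr hc⟩
  rintro z ⟨hz, hzQ⟩
  obtain ⟨q, hq, rfl⟩ := surjOn_quotMap t hz
  have hcq := (hQp q hq).mp hzQ
  obtain ⟨j, hj⟩ : ∃ j : ℕ,
      R.eval (fun i => (twist wt ((ζ ^ 5) ^ j) i : ℂ) * q.1.rep i) ≠ 0 := by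
    by_contra! h0
    exact hcq (eval_weightPart_eq_zero hprim wt h0 c)
  obtain ⟨h, hh, hhj⟩ := exists_mem_range_of_twist hζ.pow_eq_one t j
  refine ⟨h.1 q, hRU _ ?_, quotMap_of_mem_range hζ.pow_eq_one hh hq⟩
  obtain ⟨u, hu⟩ := exists_rep_diagMap (twist wt ((ζ ^ 5) ^ j)) q.1
  rw [hhj, hu, eval_scale hR]
  exact mul_ne_zero (pow_ne_zero _ u.ne_zero) hj

/-- An invariant regular function on an invariant open subset of the torus descends: if
`f Q = P` on the subset, then `f Q_c = P_c` for all weight parts, and `P_c / Q_c` is a quotient of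
homogeneous polynomials on the mirror variety. -/
theorem projRegularOn_image_quotMap {ζ : ℂˣ} (hζ : IsPrimitiveRoot ζ 1025) (t : ℂ)
    {U : Set (dworkSet secondFamily.A t)} (hUS : U ⊆ torusPart t)
    (hUH : ∀ h ∈ (cyclicHom hζ.pow_eq_one t).range, ∀ x ∈ U, h.1 x ∈ U)
    {F : mirrorSet t → ℂ} (hF : ProjRegularOn U (F ∘ quotMap t)) :
    ProjRegularOn (quotMap t '' U) F := by
  rintro _ ⟨p, hp, rfl⟩
  obtain ⟨V, hV, hpV, k, P, Q, hP, hQ, H⟩ := hF p hp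
  obtain ⟨l, R, hR, hRp, hRV⟩ := exists_principal_subset hV hpV
  have hQp : (Q * R).eval p.1.rep ≠ 0 := by
    rw [map_mul]
    exact mul_ne_zero (H p hp hpV).1 hRp
  -- multiplying by `R` makes the identity `F Q = P` valid on all of `U`
  have hFU : ∀ q ∈ U, F (quotMap t q) * (Q * R).eval q.1.rep = (P * R).eval q.1.rep := by
    intro q hq
    by_cases hRq : R.eval q.1.rep = 0
    · simp [hRq]
    · obtain ⟨h1, h2⟩ := H q hq (hRV _ hRq)
      rw [Function.comp_apply] at h2
      rw [h2, map_mul, map_mul]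
      field_simp
  have hPR := hP.mul hR
  have hQR := hQ.mul hR
  have hpart : ∀ q ∈ U, ∀ c, F (quotMap t q) * (weightPart 205 wt c (Q * R)).eval q.1.rep =
      (weightPart 205 wt c (P * R)).eval q.1.rep := by
    intro q hq c
    have h0 := eval_weightPart_eq_zero (isPrimitiveRoot_pow_five hζ) wt
      (R := F (quotMap t q) • (Q * R) - P * R) (v := q.1.rep) (fun j => ?_) c
    · rw [map_sub, map_smul, map_sub, MvPolynomial.smul_eval, sub_eq_zero] at h0
      exact h0
    · obtain ⟨h, hh, hhj⟩ := exists_mem_range_of_twist hζ.pow_eq_one t j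
      have h1 := hFU _ (hUH h hh q hq)
      rw [quotMap_of_mem_range hζ.pow_eq_one hh (hUS hq)] at h1
      obtain ⟨u, hu⟩ := exists_rep_diagMap (twist wt ((ζ ^ 5) ^ j)) q.1
      rw [hhj, hu, eval_scale hQR, eval_scale hPR] at h1
      rw [map_sub, MvPolynomial.smul_eval, sub_eq_zero]
      refine mul_left_cancel₀ (pow_ne_zero (k + l) u.ne_zero) ?_
      linear_combination h1
  obtain ⟨c, hc⟩ := exists_eval_weightPart_ne_zero (n := 205) wt hQp
  obtain ⟨N, D, P', Q', hP', hQ', HD⟩ := exists_descend_pair hPR hQR hc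
  have hprod : ∀ q ∈ torusPart t, (∏ i, monMap q.1.rep i) ^ N ≠ 0 := fun q hq =>
    pow_ne_zero _ (Finset.prod_ne_zero_iff.mpr fun i _ => monMap_ne_zero (mem_torusPart.mp hq) i)
  refine ⟨{z | Q'.eval z.rep ≠ 0}, isOpen_principal hQ', ?_, D, P', Q', hP', hQ', ?_⟩
  · refine (eval_quotMap_ne_zero_iff (hUS hp) hQ').mpr fun h0 => ?_
    have h1 := (HD _ (mem_torusPart.mp (hUS hp))).2
    rw [h0, mul_zero] at h1
    exact mul_ne_zero hc (hprod p (hUS hp)) h1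
  · rintro _ ⟨q, hq, rfl⟩ hqQ
    refine ⟨hqQ, ?_⟩
    rw [eq_div_iff hqQ]
    obtain ⟨u, hu⟩ := exists_eval_quotMap (hUS hq)
    rw [hu D P' hP', hu D Q' hQ']
    have hq' := mem_torusPart.mp (hUS hq)
    obtain ⟨h1, h2⟩ := HD _ hq'
    have h3 : q.1.rep 0 ^ c.val ≠ 0 := pow_ne_zero _ (hq' 0)
    refine mul_left_cancel₀ h3 ?_
    linear_combination (u : ℂ) ^ D * (h1 - F (quotMap t q) * h2 +
      (∏ i, monMap q.1.rep i) ^ N * hpart q hq c)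

theorem birational_cyclic {ζ : ℂˣ} (hζ : IsPrimitiveRoot ζ 1025) (t : ℂ) :
    Birational (quotient (dworkVariety secondFamily.A t) (cyclicHom hζ.pow_eq_one t).range)
      (projVariety (mirrorSet t)) := by
  have : Nonempty (dworkVariety secondFamily.A t).Pt := ⟨(exists_torus_point t).choose⟩
  exact birational_quotient (X := dworkVariety secondFamily.A t) (Y := projVariety (mirrorSet t))
    (quotMap t) (isOpen_torusPart t) (dense_torusPart t) (dense_mirrorTorus t)
    (fun h hh x hx => mem_torusPart_of_mem_range hζ.pow_eq_one hh hx)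
    (fun h hh x hx => quotMap_of_mem_range hζ.pow_eq_one hh hx)
    (mapsTo_quotMap t) (surjOn_quotMap t)
    (fun x hx y hy hxy => exists_mem_range_of_quotMap_eq hζ hx hy hxy)
    (continuousOn_quotMap t)
    (fun U hUS hU => isOpen_image_quotMap hζ t hUS hU)
    (fun V f _ _ hf => projRegularOn_comp_quotMap hf)
    (fun U hUS _ hUH F hF => projRegularOn_image_quotMap hζ t hUS hUH hF)

end MirrorQuintic

open MirrorQuintic in
theorem mainTheorem2 (ζ : ℂˣ) (hζ : IsPrimitiveRoot ζ 1025) (t : ℂ) :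
    IsCyclic (secondFamily.HA hζ.pow_eq_one t) ∧
    Nat.card (secondFamily.HA hζ.pow_eq_one t) = 41 ∧
    secondFamily.HA hζ.pow_eq_one t =
      Subgroup.zpowers (secondFamily.gHat0 hζ.pow_eq_one t) ∧
    Nonempty (secondFamily.GamA hζ.pow_eq_one t ≃*
      Multiplicative (ZMod 5 × (Fin 3 → ZMod 1025))) ∧
    orderOf (secondFamily.gHat0 hζ.pow_eq_one t ^ 185) = 41 ∧
    (∀ p : dworkSet secondFamily.A t,
      ((secondFamily.gHat0 hζ.pow_eq_one t ^ 185).1 p).1 =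
        g ζ (25 • ![(1 : ZMod 1025), 37, 16, 18, 10]) p.1) ∧
    Birational
      (quotient (dworkVariety secondFamily.A t) (secondFamily.HA hζ.pow_eq_one t))
      (mirrorVariety 5 t) := by
  have hr := range_cyclicHom hζ t
  have ho := orderOf_cyclicGen hζ t
  have hH : secondFamily.HA hζ.pow_eq_one t = (cyclicHom hζ.pow_eq_one t).range := rfl
  have hg : secondFamily.gHat0 hζ.pow_eq_one t = cyclicGen hζ.pow_eq_one t := rfl
  rw [hH, hg]
  refine ⟨?_, ?_, hr, nonempty_ker_mulEquiv hζ t, ?_, cyclicGen_pow_185_apply _ t, ?_⟩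
  · rw [hr]
    infer_instance
  · rw [hr, Nat.card_zpowers, ho]
  · rw [Nat.Coprime.orderOf_pow (by rw [ho]; norm_num), ho]
  · rw [mirrorVariety_five]
    exact birational_cyclic hζ t
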